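/- **Setting.** A polyhedral cell complex $X$ is a finite collection of convex polytopes in $\mathbb R^N$ (its faces), containing $\emptyset$, closed under passing to faces, and such that the intersection of two members is a face of both; here the faces of a polytope include the polytope itself and $\emptyset$. $X_k$ is the set of faces of dimension $k$ (dimension of the affine hull), with $X_{-1}=\{\emptyset\}$, and $|X|$ is the union of the faces. $X$ is *oriented* if each face $\sigma$ is equipped with an orientation of the linear space $\operatorname{span}\sigma$ underlying its affine hull (there is only one orientation in dimension $\le 0$). It is *labeled* if each vertex carries a monomial in $S=\mathbb C[z_1,\dots,z_n]$; a face $\sigma$ is then labeled by the least common multiple $m_\sigma$ of the labels of its vertices, $m_\emptyset=1$. If $\tau\in X_{k-1}$ is a facet of $\sigma\in X_k$, then for $k\ge1$ let $\operatorname{sign}(\tau,\sigma)=1$ if the positively oriented bases $w_1,\dots,w_{k-1}$ of $\operatorname{span}\tau$ are those for which $\eta,w_1,\dots,w_{k-1}$ is a positively oriented basis of $\operatorname{span}\sigma$, where $\eta$ is a normal vector to the affine hull of $\tau$ in that of $\sigma$ pointing inwards to $\sigma$, and $\operatorname{sign}(\tau,\sigma)=-1$ otherwise; for $k=0$ let $\operatorname{sign}(\emptyset,\sigma)=1$.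 If $\sigma'\subset\sigma$ are oriented polytopes of the same dimension, let $\operatorname{sign}(\sigma',\sigma)=1$ if their orientations of $\operatorname{span}\sigma'=\operatorname{span}\sigma$ coincide and $-1$ otherwise (it is $1$ in dimension $\le 0$). The cellular complex of $X$ consists of the free $S$-modules with bases $\{e_\sigma\}_{\sigma\in X_k}$, $k\ge-1$, and the differentials $$\varphi_k:e_\sigma\mapsto\sum_{\text{facets }\tau\subset\sigma}\operatorname{sign}(\tau,\sigma)\,\frac{m_\sigma}{m_\tau}\,e_\tau .$$ The same formula defines maps between the trivial vector bundles $E_k$ over $\mathbb C^n$ with global frames $\{e_\sigma\}_{\sigma\in X_k}$; this is the vector bundle complex of $X$. For labeled complexes, $X$ *refines* $Y$ if $|X|=|Y|$, each face of $Y$ is a union of faces of $X$, and $m_{\sigma'}\mid m_\sigma$ whenever $\sigma'\in X$, $\sigma\in Y$ and $\sigma'\subset\sigma$. **Proposition.** Let $X$ and $Y$ be oriented labeled polyhedral cell complexes such that $X$ refines $Y$, with associated complexes $E_\bullet,\varphi_\bullet$ and $F_\bullet,\psi_\bullet$ respectively. For $k\ge-1$ let $a_k:F_k\to E_k$ be the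 map $$a_k:e_\sigma\mapsto\sum_{\sigma'\in X_k,\ \sigma'\subset\sigma}\operatorname{sign}(\sigma',\sigma)\,\frac{m_\sigma}{m_{\sigma'}}\,e_{\sigma'},\qquad \sigma\in Y_k,$$ whose coefficients are a priori rational functions. Then each $a_k$ has polynomial coefficients, hence is a holomorphic map of vector bundles over $\mathbb C^n$, and $a_{k-1}\circ\psi_k=\varphi_k\circ a_k$ for all $k\ge0$, both for the cellular complexes over $S$ and for the vector bundle complexes over $\mathbb C^n$. -/

import Mathlib

namespace CellRefinement

/-- Euclidean space `ℝ^N`. -/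
abbrev Euc (N : ℕ) : Type := EuclideanSpace ℝ (Fin N)

/-- The polynomial ring `S = ℂ[z_1, …, z_n]`. -/
abbrev PolyRing (n : ℕ) : Type := MvPolynomial (Fin n) ℂ

/-- The field `ℂ(z_1, …, z_n)` of rational functions. -/
abbrev RatField (n : ℕ) : Type := FractionRing (PolyRing n)

/-- A convex polytope: the convex hull of a finite set of points (possibly empty). -/
def IsPolytope {N : ℕ} (s : Set (Euc N)) : Prop :=
  ∃ t : Set (Euc N), t.Finite ∧ s = convexHull ℝ t

/-- The dimension of the affine hull, with `dim ∅ = -1`. -/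
noncomputable def polyDim {N : ℕ} (s : Set (Euc N)) : ℤ :=
  open Classical in
  if s = ∅ then -1 else (Module.finrank ℝ (vectorSpan ℝ s) : ℤ)

/-- A polyhedral cell complex in `ℝ^N`. `IsExposed ℝ σ τ` says that `τ` is a face of the polytope
`σ`: the set of points of `σ` where some linear functional is maximal on `σ` (so `σ` itself is
included), or the empty face. -/
structure PolyhedralCellComplex (N : ℕ) where
  faces : Set (Set (Euc N))
  finite_faces : faces.Finite
  isPolytope : ∀ σ ∈ faces, IsPolytope σ
  empty_mem : ∅ ∈ faces
  face_mem : ∀ σ ∈ faces, ∀ τ, IsExposed ℝ σ τ → τ ∈ faces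
  inter_face : ∀ σ ∈ faces, ∀ τ ∈ faces, IsExposed ℝ σ (σ ∩ τ) ∧ IsExposed ℝ τ (σ ∩ τ)

/-- An orientation of the linear space `span s = {ρ₁ - ρ₂ | ρ₁, ρ₂ ∈ s}` underlying the affine
hull of `s`. -/
abbrev SpanOrientation {N : ℕ} (s : Set (Euc N)) : Type :=
  Orientation ℝ (vectorSpan ℝ s) (Fin (Module.finrank ℝ (vectorSpan ℝ s)))

/-- `w_1, …, w_m` is a positively oriented basis of `span s`. -/
def IsPosBasis {N : ℕ} {s : Set (Euc N)} (o : SpanOrientation s) {m : ℕ} (w : Fin m → Euc N) :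
    Prop :=
  ∃ (h : m = Module.finrank ℝ (vectorSpan ℝ s))
    (b : Module.Basis (Fin (Module.finrank ℝ (vectorSpan ℝ s))) ℝ (vectorSpan ℝ s)),
    b.orientation = o ∧ ∀ i, (b (Fin.cast h i) : Euc N) = w i

/-- `η` is a (nonzero) normal vector to the affine hull of `τ` in the affine hull of `σ`, pointing
inwards to `σ`. -/
def IsInwardNormal {N : ℕ} (τ σ : Set (Euc N)) (η : Euc N) : Prop :=
  η ≠ 0 ∧ η ∈ vectorSpan ℝ σ ∧ (∀ w ∈ vectorSpan ℝ τ, inner ℝ η w = 0) ∧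
    ∀ p ∈ τ, ∀ q ∈ σ, 0 ≤ inner ℝ η (q - p)

/-- `sign(τ, σ)` for a facet `τ` of `σ`: it is `1` if the orientation of `τ` is the one induced by
`σ` (`w` is positive for `τ` precisely when `η, w` is positive for `σ`, with `η` an inward normal),
and `-1` otherwise. It is `1` when `σ` is a vertex (and `τ = ∅`). -/
noncomputable def facetSign {N : ℕ} {τ σ : Set (Euc N)} (oτ : SpanOrientation τ)
    (oσ : SpanOrientation σ) : ℤ :=
  open Classical in
  if polyDim σ = 0 then 1
  else if ∃ (η : Euc N) (m : ℕ) (w : Fin m → Euc N), IsInwardNormal τ σ η ∧ IsPosBasis oτ w ∧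
      IsPosBasis oσ (Fin.cons η w : Fin (m + 1) → Euc N) then 1
  else -1

/-- `sign(σ', σ)` for `σ' ⊆ σ` of the same dimension (so `span σ' = span σ`): it is `1` if the two
orientations coincide, i.e. have a common positively oriented basis, and `-1` otherwise. -/
noncomputable def cellSign {N : ℕ} {σ' σ : Set (Euc N)} (o' : SpanOrientation σ')
    (o : SpanOrientation σ) : ℤ :=
  open Classical in
  if ∃ (m : ℕ) (w : Fin m → Euc N), IsPosBasis o' w ∧ IsPosBasis o w then 1 else -1

/-- An oriented labeled polyhedral cell complex: every face carries an orientation, and every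
vertex `v` carries a monomial `z^α`, recorded by its exponent `α = label v`. In dimension `≤ 0`
there is only one orientation, the one for which the empty basis is positive. -/
structure OrientedLabeledComplex (N n : ℕ) extends PolyhedralCellComplex N where
  orient : ∀ σ : faces, SpanOrientation (σ : Set (Euc N))
  orient_point : ∀ σ : faces, polyDim (σ : Set (Euc N)) ≤ 0 →
    IsPosBasis (orient σ) (Fin.elim0 : Fin 0 → Euc N)
  label : {v : Euc N // {v} ∈ faces} → (Fin n →₀ ℕ)

namespace OrientedLabeledComplex

variable {N n : ℕ}

/-- The set `|X|`, the union of all faces. -/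
def support (X : OrientedLabeledComplex N n) : Set (Euc N) := ⋃₀ X.faces

/-- The vertices of `X` form a finite set. -/
theorem finite_vertices (X : OrientedLabeledComplex N n) :
    Finite {v : Euc N // {v} ∈ X.faces} := by
  have := X.finite_faces.to_subtype
  refine Finite.of_injective
    (fun v : {v : Euc N // {v} ∈ X.faces} => (⟨{v.1}, v.2⟩ : X.faces)) ?_
  intro v w h
  have h' : ({v.1} : Set (Euc N)) = {w.1} := congrArg Subtype.val h
  exact Subtype.ext (Set.singleton_injective h')

noncomputable instance (X : OrientedLabeledComplex N n) :
    Fintype {v : Euc N // {v} ∈ X.faces} :=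
  @Fintype.ofFinite _ X.finite_vertices

/-- The exponent of `m_σ`, the least common multiple of the labels of the vertices in `σ`
(a vertex of `X` lies in a face `σ` exactly when it is a vertex of `σ`). -/
noncomputable def faceExp (X : OrientedLabeledComplex N n) (σ : Set (Euc N)) : Fin n →₀ ℕ :=
  open Classical in
  (Finset.univ.filter fun v : {v : Euc N // {v} ∈ X.faces} => v.1 ∈ σ).sup X.label

/-- The label `m_σ` of a face, as a monomial in `S`; `m_∅ = 1`. -/
noncomputable def mono (X : OrientedLabeledComplex N n) (σ : Set (Euc N)) : PolyRing n :=
  MvPolynomial.monomial (X.faceExp σ) 1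

/-- `X_k`, the set of faces of dimension `k`; `X_{-1} = {∅}`. -/
abbrev Cell (X : OrientedLabeledComplex N n) (k : ℤ) : Type :=
  {σ : X.faces // polyDim (σ : Set (Euc N)) = k}

/-- The underlying set of a cell. -/
abbrev Cell.set {X : OrientedLabeledComplex N n} {k : ℤ} (σ : X.Cell k) : Set (Euc N) := σ.1.1

noncomputable instance (X : OrientedLabeledComplex N n) (k : ℤ) : Fintype (X.Cell k) :=
  have := X.finite_faces.to_subtype
  Fintype.ofFinite _

/-- The free `S`-module with basis `e_σ`, `σ ∈ X_k`. -/
abbrev Chain (X : OrientedLabeledComplex N n) (k : ℤ) : Type := X.Cell k →₀ PolyRing n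

/-- The monomial `m_σ / m_τ`, for `τ ⊆ σ` faces of `X`. -/
noncomputable def quot (X : OrientedLabeledComplex N n) (σ τ : Set (Euc N)) : PolyRing n :=
  MvPolynomial.monomial (X.faceExp σ - X.faceExp τ) 1

theorem faceExp_mono (X : OrientedLabeledComplex N n) {σ τ : Set (Euc N)} (h : τ ⊆ σ) :
    X.faceExp τ ≤ X.faceExp σ := by
  classical
  unfold faceExp
  refine Finset.sup_mono ?_
  intro v hv
  simp only [Finset.mem_filter, Finset.mem_univ, true_and] at hv ⊢
  exact h hv

/-- `quot` really is the quotient of the two labels. -/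
theorem quot_mul_mono (X : OrientedLabeledComplex N n) {σ τ : Set (Euc N)} (h : τ ⊆ σ) :
    X.quot σ τ * X.mono τ = X.mono σ := by
  simp only [quot, mono, MvPolynomial.monomial_mul, mul_one,
    tsub_add_cancel_of_le (X.faceExp_mono h)]

/-- The differential `φ_k : e_σ ↦ ∑_{τ facet of σ} sign(τ, σ) (m_σ / m_τ) e_τ` of the cellular
complex supported on `X`. -/
noncomputable def diff (X : OrientedLabeledComplex N n) (k : ℤ) :
    X.Chain k →ₗ[PolyRing n] X.Chain (k - 1) :=
  open Classical in
  Finsupp.linearCombination (PolyRing n) fun σ : X.Cell k =>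
    ∑ τ ∈ Finset.univ.filter (fun τ : X.Cell (k - 1) => IsExposed ℝ σ.set τ.set),
      Finsupp.single τ
        ((facetSign (X.orient τ.1) (X.orient σ.1) : PolyRing n) * X.quot σ.set τ.set)

/-- `X` refines `Y` as labeled polyhedral cell complexes. -/
def Refines (X Y : OrientedLabeledComplex N n) : Prop :=
  X.support = Y.support ∧
  (∀ σ ∈ Y.faces, ∃ T : Set (Set (Euc N)), T ⊆ X.faces ∧ σ = ⋃₀ T) ∧
  ∀ σ' ∈ X.faces, ∀ σ ∈ Y.faces, σ' ⊆ σ → X.mono σ' ∣ Y.mono σ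

/-- The map `e_σ ↦ ∑_{σ' ∈ X_k, σ' ⊆ σ} sign(σ', σ) (m_σ / m_{σ'}) e_{σ'}` for `σ ∈ Y_k`, with the
quotients taken in the field of rational functions. -/
noncomputable def comparison (X Y : OrientedLabeledComplex N n) (k : ℤ) :
    Y.Chain k →ₗ[PolyRing n] (X.Cell k →₀ RatField n) :=
  open Classical in
  Finsupp.linearCombination (PolyRing n) fun σ : Y.Cell k =>
    ∑ σ' ∈ Finset.univ.filter (fun σ' : X.Cell k => σ'.set ⊆ σ.set),
      Finsupp.single σ'
        ((cellSign (X.orient σ'.1) (Y.orient σ.1) : RatField n) *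
          (algebraMap (PolyRing n) (RatField n) (Y.mono σ.set) /
            algebraMap (PolyRing n) (RatField n) (X.mono σ'.set)))

end OrientedLabeledComplex

/-- The inclusion of a free `S`-module into its extension to rational functions. -/
noncomputable def toRat (n : ℕ) (κ : Type) :
    (κ →₀ PolyRing n) →ₗ[PolyRing n] (κ →₀ RatField n) :=
  Finsupp.mapRange.linearMap (Algebra.linearMap (PolyRing n) (RatField n))

/-- The morphism between trivial vector bundles over `ℂ^n`, with frames indexed by `ι` and `κ`, that
is given by an `S`-linear map between free modules: at the point `z` its matrix is obtained by
evaluating the polynomial entries at `z`. -/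
noncomputable def bundleMap {n : ℕ} {ι κ : Type} [Fintype ι] [Fintype κ]
    (f : (ι →₀ PolyRing n) →ₗ[PolyRing n] (κ →₀ PolyRing n)) (z : Fin n → ℂ) :
    (ι → ℂ) →L[ℂ] (κ → ℂ) :=
  open Classical in
  LinearMap.toContinuousLinearMap
    (Matrix.toLin' (Matrix.of fun (j : κ) (i : ι) =>
      MvPolynomial.eval z (f (Finsupp.single i 1) j)))

end CellRefinement

/-! The divisibility condition in a refinement makes every quotient $m_\sigma/m_{\sigma'}$ a
monomial. In the coefficient of $e_{\tau'}$ in either composite applied to $e_\sigma$, the quotients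
telescope to $m_\sigma/m_{\tau'}$. Commutativity thus reduces to an identity of integers
(`sum_sign`) for $\tau'\subset\sigma$: $\sum_\tau
\operatorname{sign}(\tau,\sigma)\operatorname{sign}(\tau',\tau)=\sum_{\sigma'}\operatorname{sign}(\sigma',\sigma)\operatorname{sign}(\tau',\sigma')$,
over facets $\tau\supseteq\tau'$ of $\sigma$ and over $\sigma'\subset\sigma$ having $\tau'$ as a
facet.

For $k\ge1$ let $\eta$ be a unit normal of $\tau'$ in $\sigma$, and let $S$ be the sign of ($\eta$,
positive basis of $\tau'$) in $\sigma$. A term on either side is $S$ if $\eta$ is its inward normal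
and $-S$ if $-\eta$ is. On the left, a facet with inward normal $\eta$ exists, and is unique, iff
$\sigma$ lies on the closed $\eta$-side of $\tau'$ (`exists_facet`, `facet_cases`). On the right, a
cell on the $\eta$-side exists, and is unique, iff $\sigma$ has points strictly on that side
(`exists_coface`, `coface_unique`). Lying on one closed side means having no point strictly on the
other, so the two signed counts agree: if $\tau'$ crosses the interior, the left is empty and the
right cancels; otherwise each side has one term.

Orientations are compared through determinants of inner products, which make sense for families in
the ambient space and whose signs multiply like a cocycle. The bundle statements follow by
evaluating polynomials at a point, which respects matrix products. -/

namespace CellRefinement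

/-! ### Orientations and matrices of inner products -/

section CrossGram

variable {E : Type*} [NormedAddCommGroup E] [InnerProductSpace ℝ E]

/-- The determinant of the matrix of inner products of two families of vectors. For two bases of
the same subspace it is positive precisely when they have the same orientation. -/
noncomputable def crossGram {m : ℕ} (u v : Fin m → E) : ℝ :=
  (Matrix.of fun i j => inner ℝ (u i) (v j)).det

theorem crossGram_comm {m : ℕ} (u v : Fin m → E) : crossGram u v = crossGram v u := by
  rw [crossGram, ← Matrix.det_transpose, crossGram]
  congr 1
  ext i j
  simp [real_inner_comm]

theorem crossGram_self_pos {m : ℕ} {u : Fin m → E} (hu : LinearIndependent ℝ u) :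
    0 < crossGram u u :=
  (Matrix.posDef_gram_of_linearIndependent (𝕜 := ℝ) hu).det_pos

/-- The first row of the matrix is $(\langle x,y\rangle,0,\dots,0)$, so expansion along it leaves
one minor. -/
theorem crossGram_cons {m : ℕ} {x y : E} {u v : Fin m → E} (h : ∀ j, inner ℝ x (v j) = 0) :
    crossGram (Fin.cons x u : Fin (m + 1) → E) (Fin.cons y v) = inner ℝ x y * crossGram u v := by
  rw [crossGram, Matrix.det_succ_row_zero, Fin.sum_univ_succ, Finset.sum_eq_zero]
  · simp [crossGram, Matrix.submatrix]
  · intro i _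
    simp [h]

theorem crossGram_neg_cons {m : ℕ} (x : E) (u : Fin m → E) (v : Fin (m + 1) → E) :
    crossGram (Fin.cons (-x) u : Fin (m + 1) → E) v = - crossGram (Fin.cons x u) v := by
  rw [crossGram, crossGram, Matrix.det_succ_row_zero, Matrix.det_succ_row_zero,
    ← Finset.sum_neg_distrib]
  refine Finset.sum_congr rfl fun i _ => ?_
  simp [Matrix.submatrix]

/-- Expanding each $v_j$ in $b$ factors the matrix through the change-of-basis matrix; the $u_i$
need not lie in $V$. -/
theorem crossGram_eq_mul_det {V : Submodule ℝ E} {m : ℕ} (b : Module.Basis (Fin m) ℝ V)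
    (u : Fin m → E) (v : Fin m → V) :
    crossGram u (fun i => (v i : E)) = crossGram u (fun i => (b i : E)) * b.det v := by
  rw [crossGram, crossGram, Module.Basis.det_apply, ← Matrix.det_mul]
  congr 1
  ext i j
  have h : (v j : E) = ∑ k, b.toMatrix v k j • (b k : E) := by
    have := congrArg V.subtype (b.sum_toMatrix_smul_self v j)
    rw [map_sum] at this
    exact this.symm
  simp only [Matrix.of_apply, Matrix.mul_apply]
  rw [h, inner_sum]
  exact Finset.sum_congr rfl fun k _ => by rw [inner_smul_right, mul_comm]

/-- `w` is a basis of the subspace `V`. -/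
structure IsFrame (V : Submodule ℝ E) {m : ℕ} (w : Fin m → E) : Prop where
  mem : ∀ i, w i ∈ V
  linearIndependent : LinearIndependent ℝ w
  finrank_eq : m = Module.finrank ℝ V

theorem IsFrame.exists_basis {V : Submodule ℝ E} [FiniteDimensional ℝ V] {m : ℕ} {w : Fin m → E}
    (h : IsFrame V w) : ∃ b : Module.Basis (Fin m) ℝ V, ∀ i, (b i : E) = w i := by
  have hli : LinearIndependent ℝ (fun i => (⟨w i, h.mem i⟩ : V)) :=
    LinearIndependent.of_comp V.subtype h.linearIndependent
  have hc : Fintype.card (Fin m) = Module.finrank ℝ V := by simpa using h.finrank_eq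
  exact ⟨Module.Basis.mk hli (hli.span_eq_top_of_card_eq_finrank' hc).ge, fun i => by simp⟩

/-- Writing $w$ in terms of the basis $v$ pulls the same determinant out of both sides. This is the
source of transitivity and of the cocycle rule for signs. -/
theorem IsFrame.crossGram_mul {V : Submodule ℝ E} [FiniteDimensional ℝ V] {m : ℕ}
    {u v w : Fin m → E} (hv : IsFrame V v) (hw : ∀ i, w i ∈ V) :
    crossGram u v * crossGram v w = crossGram v v * crossGram u w := by
  obtain ⟨b, hb⟩ := hv.exists_basis
  obtain rfl : (fun i => (b i : E)) = v := funext hb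
  have h1 := crossGram_eq_mul_det b u (fun i => ⟨w i, hw i⟩)
  have h2 := crossGram_eq_mul_det b (fun i => (b i : E)) (fun i => ⟨w i, hw i⟩)
  simp only at h1 h2
  rw [h1, h2]
  ring

theorem IsFrame.crossGram_ne_zero {V : Submodule ℝ E} [FiniteDimensional ℝ V] {m : ℕ}
    {u v : Fin m → E} (hu : IsFrame V u) (hv : IsFrame V v) : crossGram u v ≠ 0 := by
  intro h
  have := hv.crossGram_mul (u := v) (w := u) hu.mem
  have h2 := hu.crossGram_mul (u := v) (w := v) hv.mem
  rw [h, mul_zero] at h2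
  exact (mul_pos (crossGram_self_pos hu.linearIndependent)
    (crossGram_self_pos hv.linearIndependent)).ne h2

/-- The sign of a nonzero real number. -/
noncomputable def posSign (x : ℝ) : ℤ := open Classical in if 0 < x then 1 else -1

theorem posSign_mul {x y : ℝ} (hx : x ≠ 0) (hy : y ≠ 0) :
    posSign (x * y) = posSign x * posSign y := by
  unfold posSign
  rcases hx.lt_or_gt with hx | hx <;> rcases hy.lt_or_gt with hy | hy
  · simp [hx.not_gt, hy.not_gt, mul_pos_of_neg_of_neg hx hy]
  · simp [hx.not_gt, hy, (mul_neg_of_neg_of_pos hx hy).not_gt]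
  · simp [hx, hy.not_gt, (mul_neg_of_pos_of_neg hx hy).not_gt]
  · simp [hx, hy]

theorem posSign_of_pos {x : ℝ} (hx : 0 < x) : posSign x = 1 := by simp [posSign, hx]

theorem posSign_neg {x : ℝ} (hx : x ≠ 0) : posSign (-x) = - posSign x := by
  rw [neg_eq_neg_one_mul, posSign_mul (by norm_num) hx]
  simp only [posSign, show ¬ (0 : ℝ) < -1 by norm_num, if_false, neg_one_mul]

theorem IsFrame.posSign_mul {V : Submodule ℝ E} [FiniteDimensional ℝ V] {m : ℕ}
    {u v w : Fin m → E} (hu : IsFrame V u) (hv : IsFrame V v) (hw : IsFrame V w) :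
    posSign (crossGram u v) * posSign (crossGram v w) = posSign (crossGram u w) := by
  rw [← CellRefinement.posSign_mul (hu.crossGram_ne_zero hv) (hv.crossGram_ne_zero hw),
    hv.crossGram_mul hw.mem,
    CellRefinement.posSign_mul (hv.crossGram_ne_zero hv) (hu.crossGram_ne_zero hw),
    posSign_of_pos (crossGram_self_pos hv.linearIndependent), one_mul]

theorem IsFrame.crossGram_pos_trans {V : Submodule ℝ E} [FiniteDimensional ℝ V] {m : ℕ}
    {u v w : Fin m → E} (hv : IsFrame V v) (hw : ∀ i, w i ∈ V)
    (h1 : 0 < crossGram u v) (h2 : 0 < crossGram v w) : 0 < crossGram u w := by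
  have h := mul_pos h1 h2
  rw [hv.crossGram_mul hw] at h
  exact pos_of_mul_pos_right h (crossGram_self_pos hv.linearIndependent).le

end CrossGram

/-! ### Cell and facet signs as signs of determinants -/

variable {N : ℕ}

theorem IsPosBasis.isFrame {s : Set (Euc N)} {o : SpanOrientation s} {m : ℕ} {w : Fin m → Euc N}
    (h : IsPosBasis o w) : IsFrame (vectorSpan ℝ s) w := by
  obtain ⟨rfl, b, -, hw⟩ := h
  obtain rfl : (fun i => (b i : Euc N)) = w := funext hw
  exact ⟨fun i => (b i).2,
    b.linearIndependent.map' (Submodule.subtype _) (Submodule.ker_subtype _), rfl⟩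

/-- The determinant is the positive Gram determinant of $w$ times the change-of-basis determinant,
whose sign decides equality of orientations. -/
theorem IsPosBasis.iff_crossGram_pos {s : Set (Euc N)} {o : SpanOrientation s} {m : ℕ}
    {w v : Fin m → Euc N} (h : IsPosBasis o w) :
    IsPosBasis o v ↔ (∀ i, v i ∈ vectorSpan ℝ s) ∧ 0 < crossGram w v := by
  have hw := h.isFrame
  obtain ⟨rfl, b, hb, hbw⟩ := h
  obtain rfl : (fun i => (b i : Euc N)) = w := funext hbw
  have hpos := crossGram_self_pos hw.linearIndependent
  constructor
  · rintro ⟨_, b', hb', hbv⟩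
    obtain rfl : (fun i => (b' i : Euc N)) = v := funext hbv
    refine ⟨fun i => (b' i).2, ?_⟩
    rw [crossGram_eq_mul_det b]
    exact mul_pos hpos ((b.orientation_eq_iff_det_pos b').1 (hb.trans hb'.symm))
  · rintro ⟨hv, hlt⟩
    have h1 := crossGram_eq_mul_det b (fun i => (b i : Euc N)) (fun i => ⟨v i, hv i⟩)
    simp only at h1
    rw [h1] at hlt
    have hdet := pos_of_mul_pos_right hlt hpos.le
    obtain ⟨hli, hsp⟩ := b.is_basis_iff_det.2 hdet.ne'.isUnit
    refine ⟨rfl, Module.Basis.mk hli hsp.ge, ?_, fun i => by simp⟩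
    rw [← hb, eq_comm, b.orientation_eq_iff_det_pos]
    simpa using hdet

theorem exists_isPosBasis {s : Set (Euc N)} (o : SpanOrientation s)
    (h : 0 < Module.finrank ℝ (vectorSpan ℝ s)) :
    ∃ w : Fin (Module.finrank ℝ (vectorSpan ℝ s)) → Euc N, IsPosBasis o w := by
  have : Nonempty (Fin (Module.finrank ℝ (vectorSpan ℝ s))) := ⟨⟨0, h⟩⟩
  exact ⟨fun i => (o.someBasis (by simp) i : Euc N), rfl, o.someBasis (by simp),
    o.someBasis_orientation (by simp), fun i => rfl⟩

/-- Frees the sign from the existential over common positive bases: any chosen pair computes it. -/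
theorem cellSign_eq_posSign {s' s : Set (Euc N)} {o' : SpanOrientation s'} {o : SpanOrientation s}
    {m : ℕ} {w' w : Fin m → Euc N} (hs : vectorSpan ℝ s' = vectorSpan ℝ s)
    (hw' : IsPosBasis o' w') (hw : IsPosBasis o w) :
    cellSign o' o = posSign (crossGram w' w) := by
  unfold cellSign posSign
  congr 1
  refine propext ⟨?_, fun h => ⟨m, w', hw', ?_⟩⟩
  · rintro ⟨m', v, hv', hv⟩
    obtain rfl : m' = m := hv.isFrame.finrank_eq.trans hw.isFrame.finrank_eq.symm
    refine hv.isFrame.crossGram_pos_trans hw.isFrame.mem (hw'.iff_crossGram_pos.1 hv').2 ?_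
    rw [crossGram_comm]
    exact (hw.iff_crossGram_pos.1 hv).2
  · rw [hw.iff_crossGram_pos, crossGram_comm]
    exact ⟨fun i => hs ▸ hw'.isFrame.mem i, h⟩

/-- `η` spans the orthogonal complement of `W` in `V`. -/
structure IsUnitNormal (W V : Submodule ℝ (Euc N)) (η : Euc N) : Prop where
  mem : η ∈ V
  inner_self : inner ℝ η η = (1 : ℝ)
  inner_eq_zero : ∀ w ∈ W, inner ℝ η w = (0 : ℝ)
  mem_of_inner_eq_zero : ∀ v ∈ V, inner ℝ η v = (0 : ℝ) → v ∈ W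

theorem IsUnitNormal.neg {W V : Submodule ℝ (Euc N)} {η : Euc N} (h : IsUnitNormal W V η) :
    IsUnitNormal W V (-η) where
  mem := V.neg_mem h.mem
  inner_self := by simpa using h.inner_self
  inner_eq_zero w hw := by simpa using h.inner_eq_zero w hw
  mem_of_inner_eq_zero v hv hv0 := h.mem_of_inner_eq_zero v hv (by simpa using hv0)

theorem IsUnitNormal.ne_zero {W V : Submodule ℝ (Euc N)} {η : Euc N} (h : IsUnitNormal W V η) :
    η ≠ 0 := by
  rintro rfl
  simpa using h.inner_self

theorem IsUnitNormal.sub_smul_mem {W V : Submodule ℝ (Euc N)} {η : Euc N} (h : IsUnitNormal W V η)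
    {v : Euc N} (hv : v ∈ V) : v - (inner ℝ η v : ℝ) • η ∈ W := by
  refine h.mem_of_inner_eq_zero _ (V.sub_mem hv (V.smul_mem _ h.mem)) ?_
  rw [inner_sub_right, inner_smul_right, h.inner_self, mul_one, sub_self]

/-- $W^\perp\cap V$ is a line; normalise a generator. -/
theorem exists_isUnitNormal {W V : Submodule ℝ (Euc N)} (hWV : W ≤ V)
    (hd : Module.finrank ℝ V = Module.finrank ℝ W + 1) : ∃ η, IsUnitNormal W V η := by
  have h1 : Module.finrank ℝ ↥(Wᗮ ⊓ V) = 1 := by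
    have := Submodule.finrank_add_inf_finrank_orthogonal hWV
    omega
  obtain ⟨⟨x, hxW, hxV⟩, hx0, hx⟩ := finrank_eq_one_iff'.1 h1
  have hx0' : x ≠ 0 := fun h => hx0 (Subtype.ext h)
  have hn : ‖x‖ ≠ 0 := norm_ne_zero_iff.2 hx0'
  have horth : ∀ w ∈ W, inner ℝ x w = (0 : ℝ) := fun w hw =>
    Submodule.inner_left_of_mem_orthogonal hw hxW
  refine ⟨‖x‖⁻¹ • x, V.smul_mem _ hxV, ?_, fun w hw => ?_, fun v hv hv0 => ?_⟩
  · rw [inner_smul_left, inner_smul_right, real_inner_self_eq_norm_sq]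
    simp
    field_simp
  · rw [inner_smul_left, horth w hw, mul_zero]
  · have hv0' : inner ℝ x v = (0 : ℝ) := by
      rw [inner_smul_left] at hv0
      simpa [hx0'] using hv0
    set y := v - W.starProjection v with hy
    have hyW : y ∈ Wᗮ := W.sub_starProjection_mem_orthogonal v
    have hpW : W.starProjection v ∈ W := W.starProjection_apply_mem v
    have hyV : y ∈ V := V.sub_mem hv (hWV hpW)
    obtain ⟨c, hc⟩ := hx ⟨y, hyW, hyV⟩
    have hc' : c • x = y := congrArg Subtype.val hc
    have h0 : inner ℝ x y = (0 : ℝ) := by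
      rw [hy, inner_sub_right, hv0', horth _ hpW, sub_zero]
    rw [← hc', inner_smul_right, real_inner_self_eq_norm_sq] at h0
    have hc0 : c = 0 := by simpa [hx0'] using h0
    have : v = W.starProjection v := by
      rw [← sub_eq_zero, ← hy, ← hc', hc0, zero_smul]
    rw [this]
    exact hpW

theorem IsUnitNormal.isFrame_cons {W V : Submodule ℝ (Euc N)} {η : Euc N}
    (h : IsUnitNormal W V η) (hWV : W ≤ V) {m : ℕ} {w : Fin m → Euc N} (hw : IsFrame W w)
    (hd : m + 1 = Module.finrank ℝ V) : IsFrame V (Fin.cons η w : Fin (m + 1) → Euc N) where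
  mem i := by
    refine Fin.cases ?_ (fun j => ?_) i
    · simpa using h.mem
    · simpa using hWV (hw.mem j)
  linearIndependent := by
    refine linearIndependent_finCons.2 ⟨hw.linearIndependent, fun hη => ?_⟩
    have : η ∈ W := Submodule.span_le.2 (by rintro _ ⟨i, rfl⟩; exact hw.mem i) hη
    have := h.inner_eq_zero η this
    rw [h.inner_self] at this
    exact one_ne_zero this
  finrank_eq := hd

/-- The sign of a facet can be computed with any inward normal and any positive bases. -/
theorem facetSign_eq_posSign {t s : Set (Euc N)} {oτ : SpanOrientation t} {oσ : SpanOrientation s}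
    {m : ℕ} {η : Euc N} {w : Fin m → Euc N} {u : Fin (m + 1) → Euc N}
    (hne : t.Nonempty) (hts : t ⊆ s) (hs : polyDim s ≠ 0)
    (hη : IsUnitNormal (vectorSpan ℝ t) (vectorSpan ℝ s) η) (hin : IsInwardNormal t s η)
    (hw : IsPosBasis oτ w) (hu : IsPosBasis oσ u) :
    facetSign oτ oσ = posSign (crossGram (Fin.cons η w) u) := by
  have hle : vectorSpan ℝ t ≤ vectorSpan ℝ s := vectorSpan_mono ℝ hts
  have hcons : ∀ {v : Fin m → Euc N}, IsPosBasis oτ v →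
      IsFrame (vectorSpan ℝ s) (Fin.cons η v : Fin (m + 1) → Euc N) := fun hv =>
    hη.isFrame_cons hle hv.isFrame hu.isFrame.finrank_eq
  unfold facetSign posSign
  rw [if_neg hs]
  congr 1
  refine propext ⟨?_, fun h => ⟨η, m, w, hin, hw, ?_⟩⟩
  · rintro ⟨ζ, m', v, hζ, hv, hζv⟩
    obtain rfl : m' = m := hv.isFrame.finrank_eq.trans hw.isFrame.finrank_eq.symm
    obtain ⟨p, hp⟩ := hne
    -- The difference of the two sides lies in the span of `t` and is orthogonal to it, hence
    -- vanishes.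
    have hc : ζ = (inner ℝ η ζ : ℝ) • η := by
      have hmem := hη.sub_smul_mem hζ.2.1
      set y := ζ - (inner ℝ η ζ : ℝ) • η with hy
      have h0 : inner ℝ y y = (0 : ℝ) := by
        conv_lhs => rw [hy]
        rw [inner_sub_left, inner_smul_left, hζ.2.2.1 y hmem, hη.inner_eq_zero y hmem]
        simp
      rw [inner_self_eq_zero] at h0
      rw [← sub_eq_zero, ← hy, h0]
    -- Were the factor negative, both vectors pointing inwards would force `s` into the affine hull
    -- of `t`.
    have hcpos : 0 < (inner ℝ η ζ : ℝ) := by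
      have hc0 : (inner ℝ η ζ : ℝ) ≠ 0 := fun h0 => hζ.1 (by rw [hc, h0, zero_smul])
      refine lt_of_le_of_ne ?_ hc0.symm
      by_contra hneg
      push Not at hneg
      have hz : ∀ q ∈ s, inner ℝ η (q - p) = (0 : ℝ) := fun q hq => by
        refine le_antisymm ?_ (hin.2.2.2 p hp q hq)
        have := hζ.2.2.2 p hp q hq
        rw [hc, inner_smul_left] at this
        simp only [conj_trivial] at this
        exact nonpos_of_mul_nonneg_right this hneg
      have hVW : vectorSpan ℝ s ≤ vectorSpan ℝ t := by
        rw [vectorSpan_eq_span_vsub_set_right ℝ (hts hp), Submodule.span_le]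
        rintro _ ⟨q, hq, rfl⟩
        exact hη.mem_of_inner_eq_zero _ (vsub_mem_vectorSpan ℝ hq (hts hp)) (hz q hq)
      have := hη.inner_eq_zero η (hVW hη.mem)
      rw [hη.inner_self] at this
      exact one_ne_zero this
    have h1 : 0 < crossGram (Fin.cons η w : Fin (m' + 1) → Euc N) (Fin.cons ζ v) := by
      rw [crossGram_cons (fun j => hη.inner_eq_zero _ (hv.isFrame.mem j))]
      exact mul_pos hcpos (hw.iff_crossGram_pos.1 hv).2
    refine hζv.isFrame.crossGram_pos_trans hu.isFrame.mem h1 ?_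
    exact (hζv.iff_crossGram_pos.1 hu).2
  · rw [hu.iff_crossGram_pos, crossGram_comm]
    exact ⟨(hcons hw).mem, h⟩

/-! ### Convex geometry of facets -/

/-- `p` is a point of `t` such that `t` contains a segment from `p` in every direction parallel to
`t`. -/
def IsCorePoint (t : Set (Euc N)) (p : Euc N) : Prop :=
  p ∈ t ∧ ∀ w ∈ vectorSpan ℝ t, ∃ δ : ℝ, 0 < δ ∧ ∀ r, 0 < r → r < δ → p + r • w ∈ t

/-- Any point of the relative interior works, and a nonempty convex set in finite dimension has one.
-/
theorem exists_isCorePoint {t : Set (Euc N)} (ht : Convex ℝ t) (hne : t.Nonempty) :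
    ∃ p, IsCorePoint t p := by
  obtain ⟨p, hp⟩ := hne.intrinsicInterior ht
  obtain ⟨q, hq, rfl⟩ := mem_intrinsicInterior.1 hp
  refine ⟨q, intrinsicInterior_subset hp, fun w hw => ?_⟩
  have hmem : ∀ r : ℝ, (q : Euc N) + r • w ∈ affineSpan ℝ t := fun r => by
    rw [add_comm]
    refine AffineSubspace.vadd_mem_of_mem_direction ?_ q.2
    rw [direction_affineSpan]
    exact Submodule.smul_mem _ _ hw
  let f : ℝ → affineSpan ℝ t := fun r => ⟨(q : Euc N) + r • w, hmem r⟩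
  have hf : Continuous f := by
    refine Continuous.subtype_mk ?_ _
    fun_prop
  have hf0 : f 0 = q := Subtype.ext (by simp [f])
  have hnhds : f ⁻¹' ((↑) ⁻¹' t) ∈ nhds (0 : ℝ) := by
    refine hf.continuousAt.preimage_mem_nhds ?_
    rw [hf0]
    exact mem_interior_iff_mem_nhds.1 hq
  obtain ⟨δ, hδ, hball⟩ := Metric.mem_nhds_iff.1 hnhds
  refine ⟨δ, hδ, fun r h0 hr => ?_⟩
  have : r ∈ Metric.ball (0 : ℝ) δ := by
    rw [Metric.mem_ball, Real.dist_eq, sub_zero, abs_of_pos h0]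
    exact hr
  exact hball this

/-- A face meeting the core of `t` is all of `t`. -/
theorem _root_.IsExposed.eq_of_isCorePoint {t f : Set (Euc N)} {p : Euc N} (hf : IsExposed ℝ t f)
    (hp : IsCorePoint t p) (hpf : p ∈ f) : f = t := by
  obtain ⟨l, rfl⟩ := hf ⟨p, hpf⟩
  refine Set.Subset.antisymm (fun x hx => hx.1) fun x hx => ⟨hx, fun y hy => ?_⟩
  -- Prolong the segment from `x` to `p` slightly beyond `p`: maximality of `l` at `p` then gives `l
  -- p ≤ l x`.
  obtain ⟨δ, hδ, h⟩ := hp.2 (p - x) (vsub_mem_vectorSpan ℝ hp.1 hx)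
  have h1 := hpf.2 _ (h (δ / 2) (by positivity) (by linarith))
  simp only [map_add, map_smul, map_sub, smul_eq_mul] at h1
  have h2 : l p ≤ l x := by nlinarith
  exact (hpf.2 y hy).trans h2

theorem vectorSpan_le_iff {s : Set (Euc N)} {p : Euc N} (hp : p ∈ s)
    {V : Submodule ℝ (Euc N)} : vectorSpan ℝ s ≤ V ↔ ∀ x ∈ s, x - p ∈ V := by
  rw [vectorSpan_eq_span_vsub_set_right ℝ hp, Submodule.span_le]
  simp [Set.subset_def]

theorem sub_mem_vectorSpan {s : Set (Euc N)} {p q : Euc N} (hp : p ∈ s) (hq : q ∈ s) :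
    p - q ∈ vectorSpan ℝ s :=
  vsub_mem_vectorSpan ℝ hp hq

/-- A nonempty face of full dimension is not proper. -/
theorem _root_.IsExposed.eq_of_vectorSpan_le {s f : Set (Euc N)} (hf : IsExposed ℝ s f)
    (hne : f.Nonempty) (h : vectorSpan ℝ s ≤ vectorSpan ℝ f) : f = s := by
  obtain ⟨l, rfl⟩ := hf hne
  obtain ⟨p, hp⟩ := hne
  refine Set.Subset.antisymm (fun x hx => hx.1) fun x hx => ⟨hx, fun y hy => ?_⟩
  have hker : vectorSpan ℝ {x ∈ s | ∀ y ∈ s, l y ≤ l x} ≤ LinearMap.ker (l : Euc N →ₗ[ℝ] ℝ) := by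
    rw [vectorSpan_le_iff hp]
    intro z hz
    simp only [LinearMap.mem_ker, ContinuousLinearMap.coe_coe, map_sub, sub_eq_zero]
    exact le_antisymm (hp.2 z hz.1) (hz.2 p hp.1)
  have h2 := hker (h (sub_mem_vectorSpan hx hp.1))
  simp only [LinearMap.mem_ker, ContinuousLinearMap.coe_coe, map_sub, sub_eq_zero] at h2
  exact h2 ▸ hp.2 y hy

theorem IsUnitNormal.exists_inner_ne_zero {t s : Set (Euc N)} {η p : Euc N}
    (hη : IsUnitNormal (vectorSpan ℝ t) (vectorSpan ℝ s) η) (hp : p ∈ s) :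
    ∃ q ∈ s, inner ℝ η (q - p) ≠ (0 : ℝ) := by
  by_contra! h
  have hle : vectorSpan ℝ s ≤ vectorSpan ℝ t := (vectorSpan_le_iff hp).2 fun q hq =>
    hη.mem_of_inner_eq_zero _ (sub_mem_vectorSpan hq hp) (h q hq)
  have := hη.inner_eq_zero η (hle hη.mem)
  rw [hη.inner_self] at this
  exact one_ne_zero this

/-- A facet is the locus where the linear functional given by a normal vector is extremal. -/
theorem _root_.IsExposed.facet_cases {t s : Set (Euc N)} {η p : Euc N} (ht : IsExposed ℝ s t)
    (hη : IsUnitNormal (vectorSpan ℝ t) (vectorSpan ℝ s) η) (hp : p ∈ t) :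
    ((∀ q ∈ s, (0 : ℝ) ≤ inner ℝ η (q - p)) ∨ (∀ q ∈ s, (0 : ℝ) ≤ inner ℝ (-η) (q - p))) ∧
      t = {x ∈ s | inner ℝ η (x - p) = (0 : ℝ)} := by
  obtain ⟨l, hl⟩ := ht ⟨p, hp⟩
  have hps : p ∈ s := by rw [hl] at hp; exact hp.1
  have hmax : ∀ y ∈ s, l y ≤ l p := by rw [hl] at hp; exact hp.2
  have hker : vectorSpan ℝ t ≤ LinearMap.ker (l : Euc N →ₗ[ℝ] ℝ) := by
    rw [vectorSpan_le_iff hp]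
    intro z hz
    rw [hl] at hz
    simp only [LinearMap.mem_ker, ContinuousLinearMap.coe_coe, map_sub, sub_eq_zero]
    exact le_antisymm (hmax z hz.1) (hz.2 p hps)
  -- `l` vanishes on the span of `t`, and modulo that span each `q - p` is a multiple of `η`.
  have hform : ∀ q ∈ s, l q - l p = inner ℝ η (q - p) * l η := fun q hq => by
    have := hker (hη.sub_smul_mem (sub_mem_vectorSpan hq hps))
    simp only [LinearMap.mem_ker, ContinuousLinearMap.coe_coe, map_sub, map_smul,
      smul_eq_mul] at this
    linarith
  have hc : l η ≠ 0 := fun h0 => by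
    obtain ⟨q, hq, hq0⟩ := hη.exists_inner_ne_zero hps
    have hst : t = s := by
      rw [hl]
      refine Set.Subset.antisymm (fun x hx => hx.1) fun x hx => ⟨hx, fun y hy => ?_⟩
      have h1 := hform x hx
      have h2 := hform y hy
      rw [h0, mul_zero] at h1 h2
      linarith
    exact hq0 (hη.inner_eq_zero _ (sub_mem_vectorSpan (hst ▸ hq) hp))
  refine ⟨?_, ?_⟩
  · rcases hc.lt_or_gt with hc | hc
    · left
      intro q hq
      have h1 := hform q hq
      have h2 := hmax q hq
      by_contra! hneg
      nlinarith
    · right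
      intro q hq
      have h1 := hform q hq
      have h2 := hmax q hq
      rw [inner_neg_left]
      by_contra! hneg
      nlinarith
  · ext x
    refine ⟨fun hx => ?_, fun hx => ?_⟩
    · refine ⟨?_, hη.inner_eq_zero _ (sub_mem_vectorSpan hx hp)⟩
      rw [hl] at hx
      exact hx.1
    · have h1 := hform x hx.1
      rw [hx.2, zero_mul, sub_eq_zero] at h1
      rw [hl]
      exact ⟨hx.1, fun y hy => h1 ▸ hmax y hy⟩

theorem isInwardNormal_iff {t s : Set (Euc N)} {η p : Euc N} (hp : p ∈ t)
    (hη : IsUnitNormal (vectorSpan ℝ t) (vectorSpan ℝ s) η) :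
    IsInwardNormal t s η ↔ ∀ q ∈ s, (0 : ℝ) ≤ inner ℝ η (q - p) := by
  refine ⟨fun h => h.2.2.2 p hp, fun h => ⟨hη.ne_zero, hη.mem, hη.inner_eq_zero, ?_⟩⟩
  intro p' hp' q hq
  have h1 := hη.inner_eq_zero _ (sub_mem_vectorSpan hp hp')
  have h2 := h q hq
  rw [← sub_add_sub_cancel q p p', inner_add_right, h1, add_zero]
  exact h2

theorem _root_.IsExposed.isInwardNormal_or {t s : Set (Euc N)} {η : Euc N} (ht : IsExposed ℝ s t)
    (hne : t.Nonempty) (hη : IsUnitNormal (vectorSpan ℝ t) (vectorSpan ℝ s) η) :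
    IsInwardNormal t s η ∨ IsInwardNormal t s (-η) := by
  obtain ⟨p, hp⟩ := hne
  rw [isInwardNormal_iff hp hη, isInwardNormal_iff hp hη.neg]
  exact (ht.facet_cases hη hp).1

theorem IsInwardNormal.not_neg {t s : Set (Euc N)} {η : Euc N} (hne : t.Nonempty) (hts : t ⊆ s)
    (hη : IsUnitNormal (vectorSpan ℝ t) (vectorSpan ℝ s) η) (h : IsInwardNormal t s η) :
    ¬ IsInwardNormal t s (-η) := fun h' => by
  obtain ⟨p, hp⟩ := hne
  obtain ⟨q, hq, hq0⟩ := hη.exists_inner_ne_zero (hts hp)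
  have h1 := h.2.2.2 p hp q hq
  have h2 := h'.2.2.2 p hp q hq
  rw [inner_neg_left] at h2
  exact hq0 (le_antisymm (by linarith) h1)

/-- If `s` has a point on the side of `t` determined by `η`, then it contains an initial segment
of every ray that starts at a core point of `t` and points to that side. -/
theorem exists_segment {t s : Set (Euc N)} {η p q v : Euc N} (hs : Convex ℝ s) (hts : t ⊆ s)
    (hη : IsUnitNormal (vectorSpan ℝ t) (vectorSpan ℝ s) η) (hp : IsCorePoint t p) (hq : q ∈ s)
    (hqp : (0 : ℝ) < inner ℝ η (q - p)) (hv : v ∈ vectorSpan ℝ s)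
    (hv0 : (0 : ℝ) < inner ℝ η v) :
    ∃ δ : ℝ, 0 < δ ∧ ∀ r, 0 < r → r < δ → p + r • v ∈ s := by
  set c : ℝ := inner ℝ η v with hc
  set d : ℝ := inner ℝ η (q - p) with hd
  -- With $a=rc/d$ and $w$ this vector, $p+rv=(1-a)\bigl(p+\tfrac r{1-a}w\bigr)+aq$. The bounds on
  -- $r$ below ensure $a<1/2$ and $r/(1-a)<\delta$.
  have hw : v - (c / d) • (q - p) ∈ vectorSpan ℝ t := by
    refine hη.mem_of_inner_eq_zero _
      (Submodule.sub_mem _ hv (Submodule.smul_mem _ _ (sub_mem_vectorSpan hq (hts hp.1)))) ?_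
    rw [inner_sub_right, inner_smul_right, ← hc, ← hd]
    field_simp
    ring
  obtain ⟨δ, hδ, h⟩ := hp.2 _ hw
  have hcd : 0 < c / d := div_pos hv0 hqp
  refine ⟨min (δ / 2) (d / c / 2), by positivity, fun r hr hr' => ?_⟩
  have hr1 : r < δ / 2 := hr'.trans_le (min_le_left _ _)
  have hr2 : r * (c / d) < 1 / 2 := by
    have : r < d / c / 2 := hr'.trans_le (min_le_right _ _)
    calc r * (c / d) < d / c / 2 * (c / d) := by gcongr
      _ = 1 / 2 := by field_simp
  set a : ℝ := r * (c / d) with ha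
  have ha0 : 0 < a := mul_pos hr hcd
  have h1a : 0 < 1 - a := by linarith
  have hmem := hts (h (r / (1 - a)) (by positivity) (by
    rw [div_lt_iff₀ h1a]
    nlinarith))
  have hcomb := hs hmem hq h1a.le ha0.le (by ring)
  convert hcomb using 1
  rw [smul_add, smul_smul, mul_div_cancel₀ _ h1a.ne', smul_sub r v, smul_smul, ← ha]
  module

/-! ### Closed covers and directions in general position -/

theorem IsPolytope.convex {s : Set (Euc N)} (h : IsPolytope s) : Convex ℝ s := by
  obtain ⟨t, -, rfl⟩ := h
  exact convex_convexHull ℝ t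

theorem IsPolytope.isClosed {s : Set (Euc N)} (h : IsPolytope s) : IsClosed s := by
  obtain ⟨t, ht, rfl⟩ := h
  exact ht.isClosed_convexHull ℝ

/-- An open half of `V` is not covered by finitely many subspaces that do not contain `V`. -/
theorem exists_mem_of_forall_lt (V : Submodule ℝ (Euc N)) (η : Euc N) (hη : η ∈ V) (hη0 : η ≠ 0)
    (P : Set (Submodule ℝ (Euc N))) (hP : P.Finite) (hlt : ∀ U ∈ P, ¬ V ≤ U) :
    ∃ v ∈ V, (0 : ℝ) < inner ℝ η v ∧ ∀ U ∈ P, v ∉ U := by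
  classical
  set H : Submodule ℝ (Euc N) := LinearMap.ker (innerSL ℝ η : Euc N →ₗ[ℝ] ℝ) with hH
  have hVH : ¬ V ≤ H := fun h => by
    have := h hη
    rw [hH, LinearMap.mem_ker] at this
    simp [hη0] at this
  -- A real vector space is not a finite union of proper subspaces. Including $\eta^\perp$ makes
  -- $\langle\eta,v\rangle\ne0$, so replacing $v$ by $-v$ if necessary makes it positive.
  have hfin : (insert H P).Finite := hP.insert H
  have hall : ∀ U ∈ insert H P, ¬ V ≤ U := by
    rintro U (rfl | hU)
    · exact hVH
    · exact hlt U hU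
  obtain ⟨v, hv⟩ : ∃ v : V, ∀ U ∈ insert H P, (v : Euc N) ∉ U := by
    by_contra! hcon
    have htop := Subspace.top_mem_of_biUnion_eq_univ
      (s := hfin.toFinset.image fun U => U.comap V.subtype) (by
        refine Set.eq_univ_of_forall fun v => ?_
        obtain ⟨U, hU, hvU⟩ := hcon v
        simp only [Finset.mem_image, Set.iUnion_exists, Set.mem_iUnion]
        exact ⟨U.comap V.subtype, U, ⟨hfin.mem_toFinset.2 hU, rfl⟩, hvU⟩)
    obtain ⟨U, hU, hUtop⟩ := Finset.mem_image.1 htop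
    exact hall U (hfin.mem_toFinset.1 hU) (Submodule.comap_subtype_eq_top.1 hUtop)
  have h0 : (inner ℝ η (v : Euc N) : ℝ) ≠ 0 := fun h => hv H (Set.mem_insert _ _) (by simpa [hH])
  rcases h0.lt_or_gt with h | h
  · refine ⟨-v, V.neg_mem v.2, by rw [inner_neg_right]; linarith, fun U hU hvU => ?_⟩
    exact hv U (Set.mem_insert_of_mem _ hU) (U.neg_mem_iff.1 hvU)
  · exact ⟨v, v.2, h, fun U hU => hv U (Set.mem_insert_of_mem _ hU)⟩

/-- If finitely many closed sets cover an initial segment of a ray, then one of them contains its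
origin and a further point. -/
theorem exists_mem_of_segment_subset {T : Set (Set (Euc N))} (hT : T.Finite)
    (hcl : ∀ s ∈ T, IsClosed s) {p v : Euc N} {δ : ℝ} (hδ : 0 < δ)
    (h : ∀ r, 0 < r → r < δ → p + r • v ∈ ⋃₀ T) :
    ∃ s ∈ T, p ∈ s ∧ ∃ r : ℝ, 0 < r ∧ p + r • v ∈ s := by
  -- The members missing `p` have closed union, so points of the ray near `p` avoid them.
  set A : Set (Euc N) := ⋃₀ {s ∈ T | p ∉ s} with hA
  have hAcl : IsClosed A := by
    rw [hA, Set.sUnion_eq_biUnion]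
    exact (hT.subset (Set.sep_subset _ _)).isClosed_biUnion fun s hs => hcl s hs.1
  have hpA : p ∉ A := by
    rintro ⟨s, hs, hps⟩
    exact hs.2 hps
  have hcont : Continuous fun r : ℝ => p + r • v := by fun_prop
  have hnhds : (fun r : ℝ => p + r • v) ⁻¹' Aᶜ ∈ nhds (0 : ℝ) :=
    hcont.continuousAt.preimage_mem_nhds (hAcl.isOpen_compl.mem_nhds (by simpa using hpA))
  obtain ⟨ε, hε, hball⟩ := Metric.mem_nhds_iff.1 hnhds
  have hr : 0 < min ε δ / 2 := by positivity
  have hr1 : min ε δ / 2 < ε := by linarith [min_le_left ε δ]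
  have hr2 : min ε δ / 2 < δ := by linarith [min_le_right ε δ]
  obtain ⟨s, hs, hmem⟩ := h _ hr hr2
  refine ⟨s, hs, ?_, min ε δ / 2, hr, hmem⟩
  by_contra hps
  have : min ε δ / 2 ∈ Metric.ball (0 : ℝ) ε := by
    rw [Metric.mem_ball, Real.dist_eq, sub_zero, abs_of_pos hr]
    exact hr1
  exact hball this ⟨s, ⟨hs, hps⟩, hmem⟩

variable {n : ℕ}

/-! ### Cells on the two sides of a ridge -/

theorem IsInwardNormal.exists_inner_pos {t s : Set (Euc N)} {η p : Euc N} (hp : p ∈ t)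
    (hts : t ⊆ s) (hη : IsUnitNormal (vectorSpan ℝ t) (vectorSpan ℝ s) η)
    (h : IsInwardNormal t s η) : ∃ q ∈ s, (0 : ℝ) < inner ℝ η (q - p) := by
  obtain ⟨q, hq, hq0⟩ := hη.exists_inner_ne_zero (hts hp)
  exact ⟨q, hq, lt_of_le_of_ne (h.2.2.2 p hp q hq) hq0.symm⟩

namespace PolyhedralCellComplex

theorem isExposed_of_subset (X : PolyhedralCellComplex N) {t f : Set (Euc N)} (ht : t ∈ X.faces)
    (hf : f ∈ X.faces) (htf : t ⊆ f) : IsExposed ℝ f t := by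
  have := (X.inter_face f hf t ht).1
  rwa [Set.inter_eq_self_of_subset_right htf] at this

/-- If `s` is a union of faces of `X` and has a point on the side of the face `t` determined by
`η`, then a face of `X` of full dimension in `s` is adjacent to `t` on this side. -/
theorem exists_coface (X : PolyhedralCellComplex N) {s t : Set (Euc N)} {η p : Euc N}
    (hs : Convex ℝ s) (hcov : ∃ T ⊆ X.faces, s = ⋃₀ T) (ht : t ∈ X.faces) (hts : t ⊆ s)
    (hη : IsUnitNormal (vectorSpan ℝ t) (vectorSpan ℝ s) η) (hp : IsCorePoint t p)
    (hq : ∃ q ∈ s, (0 : ℝ) < inner ℝ η (q - p)) :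
    ∃ f ∈ X.faces, f ⊆ s ∧ t ⊆ f ∧ vectorSpan ℝ f = vectorSpan ℝ s ∧ IsInwardNormal t f η := by
  obtain ⟨T, hTX, hsT⟩ := hcov
  have hTfin : T.Finite := X.finite_faces.subset hTX
  obtain ⟨q, hq, hqp⟩ := hq
  -- A generic direction: it avoids the spans of all lower-dimensional members of `T`, so the member
  -- that the ray enters has full dimension.
  obtain ⟨v, hv, hv0, hvT⟩ := exists_mem_of_forall_lt (vectorSpan ℝ s) η hη.mem hη.ne_zero
    {U | U ∈ (vectorSpan ℝ) '' T ∧ ¬ vectorSpan ℝ s ≤ U}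
    ((hTfin.image _).subset (Set.sep_subset _ _)) fun U hU => hU.2
  obtain ⟨δ, hδ, hseg⟩ := exists_segment hs hts hη hp hq hqp hv hv0
  obtain ⟨f, hfT, hpf, r, hr, hrf⟩ := exists_mem_of_segment_subset hTfin
    (fun g hg => (X.isPolytope g (hTX hg)).isClosed) hδ (fun r h1 h2 => hsT ▸ hseg r h1 h2)
  have hfs : f ⊆ s := hsT ▸ Set.subset_sUnion_of_mem hfT
  have hvf : v ∈ vectorSpan ℝ f := by
    have := sub_mem_vectorSpan hrf hpf
    rwa [add_sub_cancel_left, Submodule.smul_mem_iff _ hr.ne'] at this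
  have hspan : vectorSpan ℝ f = vectorSpan ℝ s := by
    refine le_antisymm (vectorSpan_mono ℝ hfs) ?_
    by_contra hlt
    exact hvT _ ⟨⟨f, hfT, rfl⟩, hlt⟩ hvf
  -- `t ∩ f` is a face of `t` through its core point, hence all of `t`.
  have htf : t ⊆ f := Set.inter_eq_left.1
    (((X.inter_face t ht f (hTX hfT)).1).eq_of_isCorePoint hp ⟨hp.1, hpf⟩)
  refine ⟨f, hTX hfT, hfs, htf, hspan, ?_⟩
  have hηf := hspan.symm ▸ hη
  refine ((X.isExposed_of_subset ht (hTX hfT) htf).isInwardNormal_or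
    ⟨p, hp.1⟩ hηf).resolve_right fun hneg => ?_
  have := hneg.2.2.2 p hp.1 _ hrf
  rw [add_sub_cancel_left, inner_neg_left, inner_smul_right] at this
  nlinarith

/-- Both cells contain short segments from the core point `p` in every direction of the open
half-space. Their intersection, a face of each, thus has full dimension and equals both. -/
theorem coface_unique (X : PolyhedralCellComplex N) {V : Submodule ℝ (Euc N)}
    {t f g : Set (Euc N)} {η p : Euc N} (hη : IsUnitNormal (vectorSpan ℝ t) V η)
    (hp : IsCorePoint t p) (hf : f ∈ X.faces) (hg : g ∈ X.faces) (htf : t ⊆ f) (htg : t ⊆ g)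
    (hfV : vectorSpan ℝ f = V) (hgV : vectorSpan ℝ g = V) (hfη : IsInwardNormal t f η)
    (hgη : IsInwardNormal t g η) : f = g := by
  have hpfg : p ∈ f ∩ g := ⟨htf hp.1, htg hp.1⟩
  have hpos : ∀ v ∈ V, (0 : ℝ) < inner ℝ η v → v ∈ vectorSpan ℝ (f ∩ g) := by
    intro v hv hv0
    have key : ∀ h ∈ X.faces, t ⊆ h → vectorSpan ℝ h = V → IsInwardNormal t h η →
        ∃ δ : ℝ, 0 < δ ∧ ∀ r, 0 < r → r < δ → p + r • v ∈ h := by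
      rintro h hh hth rfl hhη
      obtain ⟨q, hq, hqp⟩ := hhη.exists_inner_pos hp.1 hth hη
      exact exists_segment (X.isPolytope h hh).convex hth hη hp hq hqp hv hv0
    obtain ⟨δ, hδ, h1⟩ := key f hf htf hfV hfη
    obtain ⟨ε, hε, h2⟩ := key g hg htg hgV hgη
    have hr : 0 < min δ ε / 2 := by positivity
    have hr1 : min δ ε / 2 < δ := by linarith [min_le_left δ ε]
    have hr2 : min δ ε / 2 < ε := by linarith [min_le_right δ ε]
    have := sub_mem_vectorSpan (s := f ∩ g) ⟨h1 _ hr hr1, h2 _ hr hr2⟩ hpfg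
    rwa [add_sub_cancel_left, Submodule.smul_mem_iff _ hr.ne'] at this
  have hle : V ≤ vectorSpan ℝ (f ∩ g) := by
    intro v hv
    -- Large enough that `v + c • η` and `c • η` both lie in the open half-space; their difference
    -- is `v`.
    set c : ℝ := |inner ℝ η v| + 1 with hc
    have hc0 : 0 < c := by positivity
    have h1 := hpos (v + c • η) (V.add_mem hv (V.smul_mem _ hη.mem)) (by
      rw [inner_add_right, inner_smul_right, hη.inner_self]
      linarith [neg_abs_le (inner ℝ η v : ℝ)])
    have h2 := hpos (c • η) (V.smul_mem _ hη.mem) (by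
      rw [inner_smul_right, hη.inner_self]
      linarith)
    simpa using Submodule.sub_mem _ h1 h2
  have h1 := (X.inter_face f hf g hg).1.eq_of_vectorSpan_le ⟨p, hpfg⟩ (hfV ▸ hle)
  have h2 := (X.inter_face f hf g hg).2.eq_of_vectorSpan_le ⟨p, hpfg⟩ (hgV ▸ hle)
  exact h1.symm.trans h2

/-- If `s` lies on one side of `t ⊆ s`, then `t` is contained in a facet of `s`. -/
theorem exists_facet (Y : PolyhedralCellComplex N) {s t : Set (Euc N)} {η p : Euc N}
    (hs : s ∈ Y.faces) (hts : t ⊆ s) (hη : IsUnitNormal (vectorSpan ℝ t) (vectorSpan ℝ s) η)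
    (hp : p ∈ t) (hside : ∀ q ∈ s, (0 : ℝ) ≤ inner ℝ η (q - p)) :
    ∃ g ∈ Y.faces, IsExposed ℝ s g ∧ t ⊆ g ∧ vectorSpan ℝ g = vectorSpan ℝ t ∧
      IsInwardNormal g s η := by
  set g : Set (Euc N) := {x ∈ s | inner ℝ η (x - p) = (0 : ℝ)} with hg
  have htg : t ⊆ g := fun x hx => ⟨hts hx, hη.inner_eq_zero _ (sub_mem_vectorSpan hx hp)⟩
  have hexp : IsExposed ℝ s g := fun _ => by
    refine ⟨innerSL ℝ (-η), Set.ext fun x => ⟨fun hx => ⟨hx.1, fun y hy => ?_⟩,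
      fun hx => ⟨hx.1, le_antisymm ?_ (hside x hx.1)⟩⟩⟩
    · have h1 := hx.2
      have h2 := hside y hy
      rw [inner_sub_right] at h1 h2
      simp only [innerSL_apply_apply, inner_neg_left]
      linarith
    · have h1 := hx.2 p (hts hp)
      simp only [innerSL_apply_apply, inner_neg_left] at h1
      rw [inner_sub_right]
      linarith
  have hspan : vectorSpan ℝ g = vectorSpan ℝ t := by
    refine le_antisymm ((vectorSpan_le_iff (htg hp)).2 fun x hx => ?_) (vectorSpan_mono ℝ htg)
    exact hη.mem_of_inner_eq_zero _ (sub_mem_vectorSpan hx.1 (hts hp)) hx.2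
  refine ⟨g, Y.face_mem s hs g hexp, hexp, htg, hspan, ?_⟩
  exact (isInwardNormal_iff (htg hp) (hspan.symm ▸ hη)).2 hside

end PolyhedralCellComplex

/-! ### Signs -/

/-- Prefixing `η` to both bases keeps their determinant, so the cocycle rule eliminates the basis
`w` of the intermediate facet. -/
theorem facetSign_mul_cellSign {t' t s : Set (Euc N)} {o' : SpanOrientation t'}
    {oτ : SpanOrientation t} {oσ : SpanOrientation s} {m : ℕ} {η : Euc N} {w' w : Fin m → Euc N}
    {u : Fin (m + 1) → Euc N} (hne : t.Nonempty) (hts : t ⊆ s) (hs : polyDim s ≠ 0)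
    (hspan : vectorSpan ℝ t' = vectorSpan ℝ t)
    (hη : IsUnitNormal (vectorSpan ℝ t) (vectorSpan ℝ s) η) (hin : IsInwardNormal t s η)
    (hw' : IsPosBasis o' w') (hw : IsPosBasis oτ w) (hu : IsPosBasis oσ u) :
    facetSign oτ oσ * cellSign o' oτ = posSign (crossGram (Fin.cons η w') u) := by
  have hle : vectorSpan ℝ t ≤ vectorSpan ℝ s := vectorSpan_mono ℝ hts
  have hc : crossGram w' w =
      crossGram (Fin.cons η w' : Fin (m + 1) → Euc N) (Fin.cons η w) := by
    rw [crossGram_cons (fun j => hη.inner_eq_zero _ (hw.isFrame.mem j)), hη.inner_self, one_mul]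
  have hw'W : IsFrame (vectorSpan ℝ t) w' := hspan ▸ hw'.isFrame
  rw [facetSign_eq_posSign hne hts hs hη hin hw hu, cellSign_eq_posSign hspan hw' hw, hc,
    mul_comm]
  exact (hη.isFrame_cons hle hw'W hu.isFrame.finrank_eq).posSign_mul
    (hη.isFrame_cons hle hw.isFrame hu.isFrame.finrank_eq) hu.isFrame

theorem cellSign_mul_facetSign {t s' s : Set (Euc N)} {oτ : SpanOrientation t}
    {o' : SpanOrientation s'} {oσ : SpanOrientation s} {m : ℕ} {η : Euc N} {w : Fin m → Euc N}
    {u' u : Fin (m + 1) → Euc N} (hne : t.Nonempty) (hts : t ⊆ s') (hs : polyDim s' ≠ 0)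
    (hspan : vectorSpan ℝ s' = vectorSpan ℝ s)
    (hη : IsUnitNormal (vectorSpan ℝ t) (vectorSpan ℝ s') η) (hin : IsInwardNormal t s' η)
    (hw : IsPosBasis oτ w) (hu' : IsPosBasis o' u') (hu : IsPosBasis oσ u) :
    cellSign o' oσ * facetSign oτ o' = posSign (crossGram (Fin.cons η w) u) := by
  rw [facetSign_eq_posSign hne hts hs hη hin hw hu', cellSign_eq_posSign hspan hu' hu, mul_comm]
  exact (hη.isFrame_cons (vectorSpan_mono ℝ hts) hw.isFrame hu'.isFrame.finrank_eq).posSign_mul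
    hu'.isFrame (hspan ▸ hu.isFrame)

/-- A sum over objects that sit on either the positive or the negative side, at most one on each. -/
theorem sum_filter_eq_of_sides {ι : Type*} [Fintype ι] (P Q R : ι → Prop) [DecidablePred P]
    (A B : Prop) [Decidable A] [Decidable B] (f : ι → ℤ) (S : ℤ)
    (hQ : ∀ i, P i → Q i → ¬ R i ∧ f i = S) (hR : ∀ i, P i → R i → f i = -S)
    (hQR : ∀ i, P i → Q i ∨ R i) (hA : A ↔ ∃ i, P i ∧ Q i) (hB : B ↔ ∃ i, P i ∧ R i)
    (hQ1 : ∀ i j, P i → Q i → P j → Q j → i = j) (hR1 : ∀ i j, P i → R i → P j → R j → i = j) :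
    ∑ i ∈ Finset.univ.filter P, f i = S * ((if A then 1 else 0) - (if B then 1 else 0)) := by
  classical
  have hcard : ∀ (Q : ι → Prop) (A : Prop) [Decidable A], (A ↔ ∃ i, P i ∧ Q i) →
      (∀ i j, P i → Q i → P j → Q j → i = j) →
      ∑ i ∈ Finset.univ.filter P, (if Q i then (1 : ℤ) else 0) = if A then 1 else 0 := by
    intro Q A _ hA h1
    rw [← Finset.sum_filter, Finset.filter_filter]
    split_ifs with h
    · obtain ⟨i, hi⟩ := hA.1 h
      have : Finset.univ.filter (fun j => P j ∧ Q j) = {i} := by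
        ext j
        simp only [Finset.mem_filter, Finset.mem_univ, true_and, Finset.mem_singleton]
        exact ⟨fun hj => h1 j i hj.1 hj.2 hi.1 hi.2, fun hj => hj ▸ hi⟩
      rw [this, Finset.sum_singleton]
    · rw [Finset.sum_eq_zero]
      intro i hi
      exact absurd (hA.2 ⟨i, by simpa using hi⟩) h
  rw [← hcard Q A hA hQ1, ← hcard R B hB hR1, ← Finset.sum_sub_distrib, Finset.mul_sum]
  refine Finset.sum_congr rfl fun i hi => ?_
  have hPi : P i := by simpa using hi
  by_cases hQi : Q i
  · obtain ⟨h1, h2⟩ := hQ i hPi hQi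
    simp [hQi, h1, h2]
  · have hRi := (hQR i hPi).resolve_left hQi
    simp [hQi, hRi, hR i hPi hRi]

/-! ### Dimensions of cells -/

theorem finrank_of_polyDim {s : Set (Euc N)} {d : ℕ} (h : polyDim s = d) :
    s.Nonempty ∧ Module.finrank ℝ (vectorSpan ℝ s) = d := by
  unfold polyDim at h
  split_ifs at h with hs
  · exact ⟨Set.nonempty_iff_ne_empty.2 hs, by exact_mod_cast h⟩

theorem polyDim_eq {s : Set (Euc N)} (hs : s.Nonempty) :
    polyDim s = Module.finrank ℝ (vectorSpan ℝ s) := by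
  rw [polyDim, if_neg hs.ne_empty]

theorem neg_one_le_polyDim (s : Set (Euc N)) : -1 ≤ polyDim s := by
  unfold polyDim
  split_ifs <;> omega

theorem eq_empty_of_polyDim {s : Set (Euc N)} (h : polyDim s = -1) : s = ∅ := by
  unfold polyDim at h
  split_ifs at h with hs
  exact hs

theorem polyDim_empty : polyDim (∅ : Set (Euc N)) = -1 := by simp [polyDim]

theorem exists_eq_singleton_of_polyDim {s : Set (Euc N)} (h : polyDim s = 0) : ∃ v, s = {v} := by
  obtain ⟨⟨v, hv⟩, hd⟩ := finrank_of_polyDim (d := 0) h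
  refine ⟨v, Set.eq_singleton_iff_unique_mem.2 ⟨hv, fun x hx => ?_⟩⟩
  have := sub_mem_vectorSpan hx hv
  rw [Submodule.finrank_eq_zero.1 hd, Submodule.mem_bot, sub_eq_zero] at this
  exact this

/-! ### The sign identity -/

namespace OrientedLabeledComplex

/-- For `d = 0` an abstract orientation may be negative with no positive basis; `orient_point`
excludes this. -/
theorem exists_isPosBasis (X : OrientedLabeledComplex N n) {k : ℤ} {d : ℕ} (hk : k = d)
    (σ : X.Cell k) : ∃ w : Fin d → Euc N, IsPosBasis (X.orient σ.1) w := by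
  subst hk
  obtain ⟨-, hd⟩ := finrank_of_polyDim σ.2
  rcases Nat.eq_zero_or_pos d with rfl | hpos
  · exact ⟨_, X.orient_point σ.1 (by rw [σ.2]; rfl)⟩
  · have := CellRefinement.exists_isPosBasis (X.orient σ.1) (hpos.trans_eq hd.symm)
    rwa [hd] at this

theorem cellSign_eq_one (X Y : OrientedLabeledComplex N n) (σ' : X.faces) (σ : Y.faces)
    (h' : polyDim (σ' : Set (Euc N)) ≤ 0) (h : polyDim (σ : Set (Euc N)) ≤ 0) :
    cellSign (X.orient σ') (Y.orient σ) = 1 :=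
  if_pos ⟨0, Fin.elim0, X.orient_point σ' h', Y.orient_point σ h⟩

/-- The sign identity behind the chain map property, in positive dimension. -/
theorem sum_sign_of_pos (X Y : OrientedLabeledComplex N n) (hXY : X.Refines Y) {k : ℤ}
    (hk : 1 ≤ k) (σ : Y.Cell k) (τ' : X.Cell (k - 1)) (hsub : τ'.set ⊆ σ.set) :
    open Classical in
    ∑ τ ∈ Finset.univ.filter (fun τ : Y.Cell (k - 1) => IsExposed ℝ σ.set τ.set ∧
        τ'.set ⊆ τ.set),
      facetSign (Y.orient τ.1) (Y.orient σ.1) * cellSign (X.orient τ'.1) (Y.orient τ.1) =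
    ∑ σ' ∈ Finset.univ.filter (fun σ' : X.Cell k => σ'.set ⊆ σ.set ∧
        IsExposed ℝ σ'.set τ'.set),
      cellSign (X.orient σ'.1) (Y.orient σ.1) * facetSign (X.orient τ'.1) (X.orient σ'.1) := by
  classical
  obtain ⟨d, rfl⟩ : ∃ d : ℕ, k = (d : ℤ) + 1 := ⟨(k - 1).toNat, by omega⟩
  have hk1 : ((d : ℤ) + 1) = ((d + 1 : ℕ) : ℤ) := by push_cast; rfl
  have hk0 : ((d : ℤ) + 1 - 1) = (d : ℤ) := by ring
  obtain ⟨w', hw'⟩ := X.exists_isPosBasis hk0 τ'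
  obtain ⟨u, hu⟩ := Y.exists_isPosBasis hk1 σ
  obtain ⟨hσne, hσd⟩ := finrank_of_polyDim (σ.2.trans hk1)
  obtain ⟨hτ'ne, hτ'd⟩ := finrank_of_polyDim (τ'.2.trans hk0)
  obtain ⟨η, hη⟩ := exists_isUnitNormal (vectorSpan_mono ℝ hsub)
    (show Module.finrank ℝ (vectorSpan ℝ σ.set) = Module.finrank ℝ (vectorSpan ℝ τ'.set) + 1 by
      rw [hσd, hτ'd])
  obtain ⟨p, hp⟩ := exists_isCorePoint (X.isPolytope _ τ'.1.2).convex hτ'ne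
  have hσconv : Convex ℝ σ.set := (Y.isPolytope _ σ.1.2).convex
  have hframe : IsFrame (vectorSpan ℝ σ.set) (Fin.cons η w' : Fin (d + 1) → Euc N) :=
    hη.isFrame_cons (vectorSpan_mono ℝ hsub) hw'.isFrame hu.isFrame.finrank_eq
  have hneg : posSign (crossGram (Fin.cons (-η) w') u) =
      - posSign (crossGram (Fin.cons η w') u) := by
    rw [crossGram_neg_cons, posSign_neg (hframe.crossGram_ne_zero hu.isFrame)]
  have hpolyY : ∀ τ : Y.Cell ((d : ℤ) + 1), polyDim τ.set ≠ 0 := fun τ => by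
    rw [τ.2]; omega
  have hpolyX : ∀ τ : X.Cell ((d : ℤ) + 1), polyDim τ.set ≠ 0 := fun τ => by
    rw [τ.2]; omega
  have hspanY : ∀ τ : Y.Cell ((d : ℤ) + 1 - 1), τ'.set ⊆ τ.set →
      vectorSpan ℝ τ'.set = vectorSpan ℝ τ.set := fun τ h => by
    refine Submodule.eq_of_le_of_finrank_eq (vectorSpan_mono ℝ h) ?_
    rw [hτ'd, (finrank_of_polyDim (τ.2.trans hk0)).2]
  have hspanX : ∀ σ' : X.Cell ((d : ℤ) + 1), σ'.set ⊆ σ.set →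
      vectorSpan ℝ σ'.set = vectorSpan ℝ σ.set := fun τ h => by
    refine Submodule.eq_of_le_of_finrank_eq (vectorSpan_mono ℝ h) ?_
    rw [hσd, (finrank_of_polyDim (τ.2.trans hk1)).2]
  have hexpX : ∀ σ' : X.Cell ((d : ℤ) + 1), IsExposed ℝ σ'.set τ'.set → τ'.set ⊆ σ'.set :=
    fun σ' h => h.subset
  have coarse : ∀ ζ, IsUnitNormal (vectorSpan ℝ τ'.set) (vectorSpan ℝ σ.set) ζ →
      ∀ τ : Y.Cell ((d : ℤ) + 1 - 1), IsExposed ℝ σ.set τ.set ∧ τ'.set ⊆ τ.set →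
      IsInwardNormal τ.set σ.set ζ →
      facetSign (Y.orient τ.1) (Y.orient σ.1) * cellSign (X.orient τ'.1) (Y.orient τ.1) =
        posSign (crossGram (Fin.cons ζ w') u) := by
    intro ζ hζ τ hτ hin
    obtain ⟨w, hw⟩ := Y.exists_isPosBasis hk0 τ
    exact facetSign_mul_cellSign (hτ'ne.mono hτ.2) hτ.1.subset (hpolyY σ) (hspanY τ hτ.2)
      (hspanY τ hτ.2 ▸ hζ) hin hw' hw hu
  have fine : ∀ ζ, IsUnitNormal (vectorSpan ℝ τ'.set) (vectorSpan ℝ σ.set) ζ →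
      ∀ σ' : X.Cell ((d : ℤ) + 1), σ'.set ⊆ σ.set ∧ IsExposed ℝ σ'.set τ'.set →
      IsInwardNormal τ'.set σ'.set ζ →
      cellSign (X.orient σ'.1) (Y.orient σ.1) * facetSign (X.orient τ'.1) (X.orient σ'.1) =
        posSign (crossGram (Fin.cons ζ w') u) := by
    intro ζ hζ σ' hσ' hin
    obtain ⟨u', hu'⟩ := X.exists_isPosBasis hk1 σ'
    exact cellSign_mul_facetSign hτ'ne (hexpX σ' hσ'.2) (hpolyX σ') (hspanX σ' hσ'.1)
      ((hspanX σ' hσ'.1).symm ▸ hζ) hin hw' hu' hu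
  have coarse_iff : ∀ ζ, IsUnitNormal (vectorSpan ℝ τ'.set) (vectorSpan ℝ σ.set) ζ →
      ((∀ q ∈ σ.set, (0 : ℝ) ≤ inner ℝ ζ (q - p)) ↔ ∃ τ : Y.Cell ((d : ℤ) + 1 - 1),
        (IsExposed ℝ σ.set τ.set ∧ τ'.set ⊆ τ.set) ∧ IsInwardNormal τ.set σ.set ζ) := by
    refine fun ζ hζ => ⟨fun h => ?_, ?_⟩
    · obtain ⟨g, hgY, hexp, hsubg, hspan, hin⟩ := Y.exists_facet σ.1.2 hsub hζ hp.1 h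
      refine ⟨⟨⟨g, hgY⟩, ?_⟩, ⟨hexp, hsubg⟩, hin⟩
      rw [polyDim_eq (hτ'ne.mono hsubg), hspan, hτ'd, hk0]
    · rintro ⟨τ, hτ, hin⟩ q hq
      exact hin.2.2.2 p (hτ.2 hp.1) q hq
  have coarse_unique : ∀ ζ, IsUnitNormal (vectorSpan ℝ τ'.set) (vectorSpan ℝ σ.set) ζ →
      ∀ τ₁ τ₂ : Y.Cell ((d : ℤ) + 1 - 1), IsExposed ℝ σ.set τ₁.set ∧ τ'.set ⊆ τ₁.set →
      IsInwardNormal τ₁.set σ.set ζ → IsExposed ℝ σ.set τ₂.set ∧ τ'.set ⊆ τ₂.set →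
      IsInwardNormal τ₂.set σ.set ζ → τ₁ = τ₂ := by
    intro ζ hζ τ₁ τ₂ h₁ _ h₂ _
    -- Both facets are cut out of `σ` by the hyperplane through `p` orthogonal to `ζ`.
    have e₁ := (h₁.1.facet_cases (hspanY τ₁ h₁.2 ▸ hζ) (h₁.2 hp.1)).2
    have e₂ := (h₂.1.facet_cases (hspanY τ₂ h₂.2 ▸ hζ) (h₂.2 hp.1)).2
    exact Subtype.ext (Subtype.ext (e₁.trans e₂.symm))
  have fine_iff : ∀ ζ, IsUnitNormal (vectorSpan ℝ τ'.set) (vectorSpan ℝ σ.set) ζ →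
      ((∃ q ∈ σ.set, (0 : ℝ) < inner ℝ ζ (q - p)) ↔ ∃ σ' : X.Cell ((d : ℤ) + 1),
        (σ'.set ⊆ σ.set ∧ IsExposed ℝ σ'.set τ'.set) ∧ IsInwardNormal τ'.set σ'.set ζ) := by
    refine fun ζ hζ => ⟨fun h => ?_, ?_⟩
    · obtain ⟨f, hfX, hfs, htf, hspan, hin⟩ := X.exists_coface hσconv (hXY.2.1 _ σ.1.2)
        τ'.1.2 hsub hζ hp h
      refine ⟨⟨⟨f, hfX⟩, ?_⟩, ⟨hfs, X.isExposed_of_subset τ'.1.2 hfX htf⟩, hin⟩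
      rw [polyDim_eq (hτ'ne.mono htf), hspan, hσd, hk1]
    · rintro ⟨σ', hσ', hin⟩
      obtain ⟨q, hq, hqp⟩ := hin.exists_inner_pos hp.1 (hexpX σ' hσ'.2)
        ((hspanX σ' hσ'.1).symm ▸ hζ)
      exact ⟨q, hσ'.1 hq, hqp⟩
  have fine_unique : ∀ ζ, IsUnitNormal (vectorSpan ℝ τ'.set) (vectorSpan ℝ σ.set) ζ →
      ∀ σ₁ σ₂ : X.Cell ((d : ℤ) + 1), σ₁.set ⊆ σ.set ∧ IsExposed ℝ σ₁.set τ'.set →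
      IsInwardNormal τ'.set σ₁.set ζ → σ₂.set ⊆ σ.set ∧ IsExposed ℝ σ₂.set τ'.set →
      IsInwardNormal τ'.set σ₂.set ζ → σ₁ = σ₂ := by
    intro ζ hζ σ₁ σ₂ h₁ i₁ h₂ i₂
    exact Subtype.ext (Subtype.ext (X.coface_unique hζ hp σ₁.1.2 σ₂.1.2 (hexpX _ h₁.2)
      (hexpX _ h₂.2) (hspanX _ h₁.1) (hspanX _ h₂.1) i₁ i₂))
  rw [sum_filter_eq_of_sides
      (fun τ : Y.Cell ((d : ℤ) + 1 - 1) => IsExposed ℝ σ.set τ.set ∧ τ'.set ⊆ τ.set)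
      (fun τ : Y.Cell ((d : ℤ) + 1 - 1) => IsInwardNormal τ.set σ.set η)
      (fun τ => IsInwardNormal τ.set σ.set (-η)) _ _ _
      (posSign (crossGram (Fin.cons η w') u))
      (fun τ hτ hin => ⟨hin.not_neg (hτ'ne.mono hτ.2) hτ.1.subset (hspanY τ hτ.2 ▸ hη),
        coarse η hη τ hτ hin⟩)
      (fun τ hτ hin => (coarse (-η) hη.neg τ hτ hin).trans hneg)
      (fun τ hτ => hτ.1.isInwardNormal_or (hτ'ne.mono hτ.2) (hspanY τ hτ.2 ▸ hη))
      (coarse_iff η hη) (coarse_iff (-η) hη.neg) (coarse_unique η hη) (coarse_unique _ hη.neg),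
    sum_filter_eq_of_sides
      (fun σ' : X.Cell ((d : ℤ) + 1) => σ'.set ⊆ σ.set ∧ IsExposed ℝ σ'.set τ'.set)
      (fun σ' : X.Cell ((d : ℤ) + 1) => IsInwardNormal τ'.set σ'.set η)
      (fun σ' => IsInwardNormal τ'.set σ'.set (-η)) _ _ _
      (posSign (crossGram (Fin.cons η w') u))
      (fun σ' hσ' hin => ⟨hin.not_neg hτ'ne (hexpX σ' hσ'.2) ((hspanX σ' hσ'.1).symm ▸ hη),
        fine η hη σ' hσ' hin⟩)
      (fun σ' hσ' hin => (fine (-η) hη.neg σ' hσ' hin).trans hneg)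
      (fun σ' hσ' => hσ'.2.isInwardNormal_or hτ'ne ((hspanX σ' hσ'.1).symm ▸ hη))
      (fine_iff η hη) (fine_iff (-η) hη.neg) (fine_unique η hη) (fine_unique _ hη.neg)]
  congr 1
  -- The coarse conditions negate the fine ones for the opposite normal, and $[\neg B]-[\neg
  -- A]=[A]-[B]$.
  have hA : (∀ q ∈ σ.set, (0 : ℝ) ≤ inner ℝ η (q - p)) ↔
      ¬ ∃ q ∈ σ.set, (0 : ℝ) < inner ℝ (-η) (q - p) := by
    push Not
    simp only [inner_neg_left, Left.neg_nonpos_iff]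
  have hB : (∀ q ∈ σ.set, (0 : ℝ) ≤ inner ℝ (-η) (q - p)) ↔
      ¬ ∃ q ∈ σ.set, (0 : ℝ) < inner ℝ η (q - p) := by
    push Not
    simp only [inner_neg_left, Left.nonneg_neg_iff]
  simp only [hA, hB]
  split_ifs <;> simp

/-- The sign identity behind the chain map property. -/
theorem sum_sign (X Y : OrientedLabeledComplex N n) (hXY : X.Refines Y) {k : ℤ}
    (σ : Y.Cell k) (τ' : X.Cell (k - 1)) :
    open Classical in
    ∑ τ ∈ Finset.univ.filter (fun τ : Y.Cell (k - 1) => IsExposed ℝ σ.set τ.set ∧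
        τ'.set ⊆ τ.set),
      facetSign (Y.orient τ.1) (Y.orient σ.1) * cellSign (X.orient τ'.1) (Y.orient τ.1) =
    ∑ σ' ∈ Finset.univ.filter (fun σ' : X.Cell k => σ'.set ⊆ σ.set ∧
        IsExposed ℝ σ'.set τ'.set),
      cellSign (X.orient σ'.1) (Y.orient σ.1) * facetSign (X.orient τ'.1) (X.orient σ'.1) := by
  classical
  by_cases hsub : τ'.set ⊆ σ.set
  swap
  · rw [Finset.filter_false_of_mem fun τ _ h => hsub (h.2.trans h.1.subset),
      Finset.filter_false_of_mem fun σ' _ h => hsub (h.2.subset.trans h.1),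
      Finset.sum_empty, Finset.sum_empty]
  by_cases hk : 1 ≤ k
  · exact sum_sign_of_pos X Y hXY hk σ τ' hsub
  have hk0 : k = 0 := by
    have h1 := neg_one_le_polyDim τ'.set
    rw [τ'.2] at h1
    omega
  subst hk0
  have hτ' : τ'.set = ∅ := eq_empty_of_polyDim τ'.2
  obtain ⟨v, hv⟩ : ∃ v, σ.set = {v} := exists_eq_singleton_of_polyDim σ.2
  have hdim : polyDim ({v} : Set (Euc N)) = 0 := hv ▸ σ.2
  -- For `k = 0` both sums have a single term equal to `1`. The vertex belongs to `X` because a face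
  -- of `X` containing `v` inside `{v}` can only be `{v}`.
  have hvX : ({v} : Set (Euc N)) ∈ X.faces := by
    obtain ⟨T, hT, hσT⟩ := hXY.2.1 _ σ.1.2
    have hmem : v ∈ ⋃₀ T := by rw [← hσT]; exact hv.ge (Set.mem_singleton v)
    obtain ⟨f, hf, hvf⟩ := hmem
    have hfv : f ⊆ {v} := by
      have := Set.subset_sUnion_of_mem hf
      rwa [← hσT, show (σ.1 : Set (Euc N)) = {v} from hv] at this
    rw [← Set.Subset.antisymm hfv (Set.singleton_subset_iff.2 hvf)]
    exact hT hf
  have hempty : polyDim (∅ : Set (Euc N)) = 0 - 1 := polyDim_empty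
  have h1 : Finset.univ.filter (fun τ : Y.Cell (0 - 1) => IsExposed ℝ σ.set τ.set ∧
      τ'.set ⊆ τ.set) = {⟨⟨∅, Y.empty_mem⟩, hempty⟩} := by
    ext τ
    have hτ : τ.set = ∅ := eq_empty_of_polyDim τ.2
    simp only [Finset.mem_filter, Finset.mem_univ, true_and, Finset.mem_singleton]
    refine ⟨fun _ => Subtype.ext (Subtype.ext hτ), fun _ => ?_⟩
    rw [hτ, hτ']
    exact ⟨isExposed_empty, Set.Subset.rfl⟩
  have h2 : Finset.univ.filter (fun σ' : X.Cell 0 => σ'.set ⊆ σ.set ∧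
      IsExposed ℝ σ'.set τ'.set) = {⟨⟨{v}, hvX⟩, hdim⟩} := by
    ext σ'
    simp only [Finset.mem_filter, Finset.mem_univ, true_and, Finset.mem_singleton]
    constructor
    · rintro ⟨hs, -⟩
      refine Subtype.ext (Subtype.ext ?_)
      rw [hv] at hs
      exact (Set.subset_singleton_iff_eq.1 hs).resolve_left
        (finrank_of_polyDim (d := 0) σ'.2).1.ne_empty
    · rintro rfl
      rw [hτ', hv]
      exact ⟨Set.Subset.rfl, isExposed_empty⟩
  rw [h1, h2, Finset.sum_singleton, Finset.sum_singleton]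
  rw [cellSign_eq_one X Y _ _ (by rw [τ'.2]; norm_num) (by rw [hempty]; norm_num),
    cellSign_eq_one X Y _ _ hdim.le σ.2.le]
  rw [facetSign, facetSign, if_pos σ.2, if_pos hdim]

end OrientedLabeledComplex

namespace OrientedLabeledComplex

/-! ### The comparison map with polynomial coefficients -/

/-- The comparison map `a_k` of a refinement, with polynomial coefficients. -/
noncomputable def polyComparison (X Y : OrientedLabeledComplex N n) (k : ℤ) :
    Y.Chain k →ₗ[PolyRing n] X.Chain k :=
  open Classical in
  Finsupp.linearCombination (PolyRing n) fun σ : Y.Cell k =>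
    ∑ σ' ∈ Finset.univ.filter (fun σ' : X.Cell k => σ'.set ⊆ σ.set),
      Finsupp.single σ'
        ((cellSign (X.orient σ'.1) (Y.orient σ.1) : PolyRing n) *
          MvPolynomial.monomial (Y.faceExp σ.set - X.faceExp σ'.set) 1)

/-- Guarantees that the truncated subtraction of exponents in `polyComparison` is exact. -/
theorem Refines.faceExp_le {X Y : OrientedLabeledComplex N n} (h : X.Refines Y)
    {σ' σ : Set (Euc N)} (hσ' : σ' ∈ X.faces) (hσ : σ ∈ Y.faces) (hs : σ' ⊆ σ) :
    X.faceExp σ' ≤ Y.faceExp σ := by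
  have := h.2.2 σ' hσ' σ hσ hs
  rw [mono, mono, MvPolynomial.monomial_dvd_monomial] at this
  exact this.1.resolve_left one_ne_zero

theorem Refines.monomial_mul_mono {X Y : OrientedLabeledComplex N n} (h : X.Refines Y)
    {σ' σ : Set (Euc N)} (hσ' : σ' ∈ X.faces) (hσ : σ ∈ Y.faces) (hs : σ' ⊆ σ) :
    MvPolynomial.monomial (Y.faceExp σ - X.faceExp σ') 1 * X.mono σ' = Y.mono σ := by
  rw [mono, mono, MvPolynomial.monomial_mul, mul_one,
    tsub_add_cancel_of_le (h.faceExp_le hσ' hσ hs)]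

theorem mono_ne_zero (X : OrientedLabeledComplex N n) (σ : Set (Euc N)) : X.mono σ ≠ 0 := by
  simp [mono]

theorem monomial_add_one (a b : Fin n →₀ ℕ) : (MvPolynomial.monomial (a + b) 1 : PolyRing n) =
    MvPolynomial.monomial a 1 * MvPolynomial.monomial b 1 := by
  rw [MvPolynomial.monomial_mul, one_mul]

open Classical in
theorem sum_filter_single_apply {ι R : Type*} [Fintype ι] [Semiring R] (P : ι → Prop) (f : ι → R)
    (j : ι) : (∑ i ∈ Finset.univ.filter P, Finsupp.single i (f i)) j = if P j then f j else 0 := by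
  simp [Finsupp.finsetSum_apply, Finsupp.single_apply, Finset.sum_ite_eq']

open Classical in
theorem polyComparison_single_apply (X Y : OrientedLabeledComplex N n) (k : ℤ) (σ : Y.Cell k)
    (c : PolyRing n) (σ' : X.Cell k) :
    X.polyComparison Y k (Finsupp.single σ c) σ' =
      if σ'.set ⊆ σ.set then c * ((cellSign (X.orient σ'.1) (Y.orient σ.1) : PolyRing n) *
        MvPolynomial.monomial (Y.faceExp σ.set - X.faceExp σ'.set) 1) else 0 := by
  rw [polyComparison, Finsupp.linearCombination_single, Finsupp.smul_apply,
    sum_filter_single_apply]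
  split_ifs <;> simp

open Classical in
theorem diff_single_apply (X : OrientedLabeledComplex N n) (k : ℤ) (σ : X.Cell k)
    (c : PolyRing n) (τ : X.Cell (k - 1)) :
    X.diff k (Finsupp.single σ c) τ =
      if IsExposed ℝ σ.set τ.set then
        c * ((facetSign (X.orient τ.1) (X.orient σ.1) : PolyRing n) * X.quot σ.set τ.set)
      else 0 := by
  rw [diff, Finsupp.linearCombination_single, Finsupp.smul_apply, sum_filter_single_apply]
  split_ifs <;> simp

theorem toRat_comp_polyComparison {X Y : OrientedLabeledComplex N n} (h : X.Refines Y) (k : ℤ) :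
    toRat n (X.Cell k) ∘ₗ X.polyComparison Y k = comparison X Y k := by
  classical
  refine Finsupp.lhom_ext' fun σ => LinearMap.ext_ring (Finsupp.ext fun σ' => ?_)
  simp only [LinearMap.comp_apply, Finsupp.lsingle_apply]
  rw [comparison, Finsupp.linearCombination_single, one_smul, sum_filter_single_apply]
  simp only [toRat, Finsupp.mapRange.linearMap_apply, Finsupp.mapRange_apply,
    Algebra.linearMap_apply]
  rw [polyComparison_single_apply]
  split_ifs with hs
  · rw [one_mul, map_mul, map_intCast, ← h.monomial_mul_mono σ'.1.2 σ.1.2 hs, map_mul,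
      mul_div_cancel_right₀]
    exact (map_ne_zero_iff _ (IsFractionRing.injective (PolyRing n) (RatField n))).2
      (X.mono_ne_zero _)
  · simp

/-- Exponents telescope through the intermediate cell, so every term carries the same monomial and
only `sum_sign` remains. -/
theorem polyComparison_comp_diff {X Y : OrientedLabeledComplex N n} (h : X.Refines Y) (k : ℤ) :
    X.polyComparison Y (k - 1) ∘ₗ Y.diff k = X.diff k ∘ₗ X.polyComparison Y k := by
  classical
  refine Finsupp.lhom_ext' fun σ => LinearMap.ext_ring (Finsupp.ext fun τ' => ?_)
  simp only [LinearMap.comp_apply, Finsupp.lsingle_apply]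
  have hl : X.polyComparison Y (k - 1) (Y.diff k (Finsupp.single σ 1)) τ' =
      ((∑ τ ∈ Finset.univ.filter (fun τ : Y.Cell (k - 1) => IsExposed ℝ σ.set τ.set ∧
        τ'.set ⊆ τ.set), facetSign (Y.orient τ.1) (Y.orient σ.1) *
          cellSign (X.orient τ'.1) (Y.orient τ.1) : ℤ) : PolyRing n) *
        MvPolynomial.monomial (Y.faceExp σ.set - X.faceExp τ'.set) 1 := by
    rw [diff, Finsupp.linearCombination_single, one_smul, map_sum, Finsupp.finsetSum_apply,
      ← Finset.filter_filter, Finset.sum_filter (fun τ : Y.Cell (k - 1) => τ'.set ⊆ τ.set),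
      Int.cast_sum, Finset.sum_mul]
    refine Finset.sum_congr rfl fun τ hτ => ?_
    have hσ : τ.set ⊆ σ.set := (Finset.mem_filter.1 hτ).2.subset
    rw [polyComparison_single_apply]
    split_ifs with hs
    · have hexp : Y.faceExp σ.set - X.faceExp τ'.set =
          (Y.faceExp σ.set - Y.faceExp τ.set) + (Y.faceExp τ.set - X.faceExp τ'.set) :=
        (tsub_add_tsub_cancel (Y.faceExp_mono hσ) (h.faceExp_le τ'.1.2 τ.1.2 hs)).symm
      rw [hexp, quot, monomial_add_one]
      push_cast
      ring
    · simp
  have hr : X.diff k (X.polyComparison Y k (Finsupp.single σ 1)) τ' =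
      ((∑ σ' ∈ Finset.univ.filter (fun σ' : X.Cell k => σ'.set ⊆ σ.set ∧
        IsExposed ℝ σ'.set τ'.set), cellSign (X.orient σ'.1) (Y.orient σ.1) *
          facetSign (X.orient τ'.1) (X.orient σ'.1) : ℤ) : PolyRing n) *
        MvPolynomial.monomial (Y.faceExp σ.set - X.faceExp τ'.set) 1 := by
    rw [polyComparison, Finsupp.linearCombination_single, one_smul, map_sum,
      Finsupp.finsetSum_apply, ← Finset.filter_filter,
      Finset.sum_filter (fun σ' : X.Cell k => IsExposed ℝ σ'.set τ'.set),
      Int.cast_sum, Finset.sum_mul]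
    refine Finset.sum_congr rfl fun σ' hσ' => ?_
    have hσ : σ'.set ⊆ σ.set := (Finset.mem_filter.1 hσ').2
    rw [diff_single_apply]
    split_ifs with hs
    · have hexp : Y.faceExp σ.set - X.faceExp τ'.set =
          (Y.faceExp σ.set - X.faceExp σ'.set) + (X.faceExp σ'.set - X.faceExp τ'.set) :=
        (tsub_add_tsub_cancel (h.faceExp_le σ'.1.2 σ.1.2 hσ) (X.faceExp_mono hs.subset)).symm
      rw [hexp, quot, monomial_add_one]
      push_cast
      ring
    · simp
  rw [hl, hr, sum_sign X Y h σ τ']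

end OrientedLabeledComplex

/-! ### Maps of trivial vector bundles -/

section Bundle

variable {ι κ μ : Type} [Fintype ι] [Fintype κ] [Fintype μ]

theorem bundleMap_single [DecidableEq ι]
    (f : (ι →₀ PolyRing n) →ₗ[PolyRing n] (κ →₀ PolyRing n)) (z : Fin n → ℂ)
    (i : ι) (j : κ) :
    bundleMap f z (Pi.single i 1) j = MvPolynomial.eval z (f (Finsupp.single i 1) j) := by
  simp [bundleMap, Matrix.toLin'_apply, Matrix.mulVec, dotProduct, Pi.single_apply]

/-- Evaluation at `z` is a ring homomorphism, so it carries products of polynomial matrices to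
products. -/
theorem bundleMap_comp (g : (κ →₀ PolyRing n) →ₗ[PolyRing n] (μ →₀ PolyRing n))
    (f : (ι →₀ PolyRing n) →ₗ[PolyRing n] (κ →₀ PolyRing n)) (z : Fin n → ℂ) :
    bundleMap (g ∘ₗ f) z = bundleMap g z ∘L bundleMap f z := by
  classical
  ext v l
  simp only [bundleMap, LinearMap.coe_toContinuousLinearMap', ContinuousLinearMap.comp_apply,
    Matrix.toLin'_apply, Matrix.mulVec_mulVec]
  congr 2
  ext l i
  simp only [Matrix.of_apply, Matrix.mul_apply, LinearMap.comp_apply]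
  have hf : f (Finsupp.single i 1) = ∑ j, f (Finsupp.single i 1) j • Finsupp.single j 1 := by
    ext j
    simp
  have hg : g (f (Finsupp.single i 1)) l =
      ∑ j, f (Finsupp.single i 1) j * g (Finsupp.single j 1) l := by
    conv_lhs => rw [hf, map_sum, Finsupp.finsetSum_apply]
    simp only [map_smul, Finsupp.smul_apply, smul_eq_mul]
  rw [hg, map_sum]
  exact Finset.sum_congr rfl fun j _ => by rw [map_mul, mul_comm]

theorem differentiable_eval (p : PolyRing n) :
    Differentiable ℂ fun z : Fin n → ℂ => MvPolynomial.eval z p := by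
  induction p using MvPolynomial.induction_on with
  | C a => simp
  | add p q hp hq => simp only [map_add]; exact hp.add hq
  | mul_X p i hp => simp only [map_mul, MvPolynomial.eval_X]; exact hp.mul (differentiable_apply i)

theorem differentiable_bundleMap
    (f : (ι →₀ PolyRing n) →ₗ[PolyRing n] (κ →₀ PolyRing n)) :
    Differentiable ℂ fun z : Fin n → ℂ => bundleMap f z := by
  classical
  let L : (κ → ι → ℂ) →ₗ[ℂ] ((ι → ℂ) →L[ℂ] (κ → ℂ)) :=
    LinearMap.toContinuousLinearMap.toLinearMap ∘ₗ Matrix.toLin'.toLinearMap ∘ₗ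
      (Matrix.ofLinearEquiv ℂ).toLinearMap
  have hL : Differentiable ℂ L := (LinearMap.toContinuousLinearMap L).differentiable
  refine hL.comp (f := fun z j i => MvPolynomial.eval z (f (Finsupp.single i 1) j)) ?_
  exact differentiable_pi.2 fun j => differentiable_pi.2 fun i => differentiable_eval _

end Bundle

end CellRefinement

open CellRefinement in
theorem proposition4p2 {N n : ℕ} (X Y : OrientedLabeledComplex N n) (hXY : X.Refines Y) :
    ∃ a : ∀ k : ℤ, Y.Chain k →ₗ[PolyRing n] X.Chain k,
      -- the maps of the proposition have polynomial entries: they are `a k`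
      (∀ k, toRat n (X.Cell k) ∘ₗ a k = OrientedLabeledComplex.comparison X Y k) ∧
      -- they form a chain map of cellular complexes over the polynomial ring
      (∀ k, a (k - 1) ∘ₗ Y.diff k = X.diff k ∘ₗ a k) ∧
      -- as maps of trivial vector bundles over `ℂ^n` they are holomorphic
      (∀ k, Differentiable ℂ (fun z : Fin n → ℂ => bundleMap (a k) z)) ∧
      -- and given by the same formula wherever the denominators do not vanish
      (open Classical in
        ∀ k (z : Fin n → ℂ) (σ : Y.Cell k) (σ' : X.Cell k),
          MvPolynomial.eval z (X.mono σ'.set) ≠ 0 →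
            bundleMap (a k) z (Pi.single σ 1) σ' =
              if σ'.set ⊆ σ.set then
                (cellSign (X.orient σ'.1) (Y.orient σ.1) : ℂ) *
                  (MvPolynomial.eval z (Y.mono σ.set) / MvPolynomial.eval z (X.mono σ'.set))
              else 0) ∧
      -- the diagram of vector bundle complexes over `ℂ^n` commutes
      (∀ k (z : Fin n → ℂ),
        bundleMap (a (k - 1)) z ∘L bundleMap (Y.diff k) z =
          bundleMap (X.diff k) z ∘L bundleMap (a k) z) := by
  classical
  refine ⟨fun k => X.polyComparison Y k,
    OrientedLabeledComplex.toRat_comp_polyComparison hXY,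
    OrientedLabeledComplex.polyComparison_comp_diff hXY,
    fun k => differentiable_bundleMap _, fun k z σ σ' hz => ?_, fun k z => ?_⟩
  · have hsingle := bundleMap_single (X.polyComparison Y k) z σ σ'
    rw [OrientedLabeledComplex.polyComparison_single_apply] at hsingle
    refine hsingle.trans ?_
    split_ifs with hs
    · rw [← hXY.monomial_mul_mono σ'.1.2 σ.1.2 hs, map_mul (MvPolynomial.eval z) _ (X.mono _),
        mul_div_cancel_right₀ _ hz]
      simp
    · simp
  · rw [← bundleMap_comp, ← bundleMap_comp,
      OrientedLabeledComplex.polyComparison_comp_diff hXY]
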